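/- For integers $n_1,\dots,n_d\ge 1$ with $n_d>1$ let $$\zeta(n_1,\dots,n_d)=\sum_{0<k_1<\cdots<k_d}\frac{1}{k_1^{n_1}\cdots k_d^{n_d}}$$ (a convergent series), and put $\zeta(0)=-\tfrac12$. Let $n_1,n_2\ge 1$ and $n_3>1$ be integers such that $w=n_1+n_2+n_3$ is even. Then the series defining $\zeta(n_1,n_2,n_3)$ converges and $$\begin{aligned} \zeta(n_1,n_2,n_3)={}&-\frac12\Big(\zeta(n_1+n_2,n_3)+\zeta(n_1,n_2+n_3)+\zeta(w)\Big)\\ &+(-1)^{n_1}\sum_{\substack{\mu+\nu+2s=w\\ \mu\ge n_2,\ \nu\ge n_3}}\zeta(2s)\binom{\mu-1}{n_2-1}\binom{\nu-1}{n_3-1}\zeta(\mu,\nu)\\ &+(-1)^{n_2}\sum_{\substack{\mu+\nu+2s=w\\ \mu\ge n_3,\ \nu> n_1}}\zeta(2s)\binom{\mu-1}{n_3-1}\binom{\nu-1}{n_1-1}\zeta(\mu)\zeta(\nu)(-1)^{\mu}\\ &+(-1)^{n_3}\sum_{\substack{\mu+\nu+2s=w\\ \mu\ge n_2,\ \nu>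 n_1}}\zeta(2s)\binom{\mu-1}{n_2-1}\binom{\nu-1}{n_1-1}\zeta(\mu,\nu)\\ &-(-1)^{n_3}\sum_{\substack{n_1+\nu+2s=w\\ \nu> n_2}}\zeta(2s)\binom{\nu-1}{n_2-1}\Big(\zeta(n_1,\nu)+\zeta(n_1+\nu)\Big), \end{aligned}$$ where the summation indices $\mu,\nu,s$ are integers with $s\ge 0$. -/

import Mathlib

open Finset BigOperators

noncomputable section

/-- The strictly increasing sequences `0 < k₁ < ⋯ < k_d` of integers. -/
def MZVIndex (d : ℕ) : Type :=
  {k : Fin d → ℕ // (∀ i, 0 < k i) ∧ StrictMono k}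

/-- The summand `1 / (k₁ ^ n₁ ⋯ k_d ^ n_d)`. -/
def mzvTerm {d : ℕ} (n : Fin d → ℕ) (k : MZVIndex d) : ℝ :=
  1 / ∏ i, (k.1 i : ℝ) ^ n i

/-- The multiple zeta value `ζ(n₁, …, n_d) = ∑_{0 < k₁ < ⋯ < k_d} 1 / (k₁ ^ n₁ ⋯ k_d ^ n_d)`.
The series converges when all `n i` are positive and the last one is greater than `1`. -/
def mzv {d : ℕ} (n : Fin d → ℕ) : ℝ :=
  ∑' k : MZVIndex d, mzvTerm n k

/-- `ζ(2s)` for an integer `s ≥ 0`, where `ζ(0) = -1/2`. -/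
def evenZeta (s : ℕ) : ℝ :=
  if s = 0 then -1 / 2 else mzv ![2 * s]

/-- The sum of `f s μ ν` over all integers `s, μ, ν ≥ 0` with
`μ + ν + 2s = w`, `μ ≥ a` and `ν ≥ b`. -/
def weightSum (w a b : ℕ) (f : ℕ → ℕ → ℕ → ℝ) : ℝ :=
  ∑ μ ∈ Icc a w, ∑ ν ∈ Icc b w, ∑ s ∈ range (w + 1),
    if μ + ν + 2 * s = w then f s μ ν else 0

end

open Filter Topology

noncomputable section

/-! Fix p, q > 0 and sum R(j) = (j+p)^(-n₁) j^(-n₂) (j-q)^(-n₃) over the integers j away from the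
poles. The residue theorem with the kernel -π cot(πt)/2 = ∑_{s ≥ 0} ζ(2s) t^(2s-1) evaluates this
sum by Laurent coefficients of R at -p, 0 and q, which produce the products of ζ(2s) with binomial
coefficients. No contour is needed: partial fractions reduce everything to a single pole
(`tendsto_lineTerm`).

The result is then summed over p and q. Since ∑_p (j+p)^(-n₁) may diverge, p^(-n₁) is subtracted
first; the family in (p, j) becomes absolutely summable and both orders of summation agree
(`hasSum_residue`). With p inside, the j < 0 give a tail of ζ(n₁,n₂,n₃), and the j > 0 give -g(j)
(j-q)^(-n₃) with g(j) = j^(-n₂) ∑_{m ≤ j} m^(-n₁).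

To sum the latter over q, g(q) is subtracted from g(j). The series of (g(j) - g(q)) (j-q)^(-n₃) over
ℤ² converges absolutely and vanishes, because it telescopes along each line j - q = d. Its part q >
0 is therefore minus its part q ≤ 0, where g(q) = 0, and that part is ζ(n₁,n₂,n₃) plus three values
of lower depth (`hasSum_harmonicDifference`). Even weight makes the two occurrences of ζ(n₁,n₂,n₃)
add up instead of cancelling. The two subtractions also absorb the possibly divergent layers ν = n₁
and μ = n₂ of the residue sums, whence the strict inequalities in the formula. -/

/-! ### Inverse powers of integers and their differences -/

/-- The power `k ^ (-n)` of an integer, with value `0` at `k = 0` when `n` is positive. -/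
def invPow (n : ℕ) (k : ℤ) : ℝ := ((k : ℝ)⁻¹) ^ n

lemma invPow_zero_left (k : ℤ) : invPow 0 k = 1 := by simp [invPow]

lemma invPow_zero_right {n : ℕ} (hn : 1 ≤ n) : invPow n 0 = 0 := by
  simp [invPow, show n ≠ 0 by omega]

lemma invPow_neg (n : ℕ) (k : ℤ) : invPow n (-k) = (-1) ^ n * invPow n k := by
  rw [invPow, invPow, ← mul_pow]
  push_cast
  rw [inv_neg, neg_one_mul]

lemma invPow_mul_invPow (a b : ℕ) (k : ℤ) : invPow a k * invPow b k = invPow (a + b) k := by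
  simp [invPow, pow_add]

lemma invPow_nonneg_of_nonneg (n : ℕ) {k : ℤ} (hk : 0 ≤ k) : 0 ≤ invPow n k := by
  have : (0 : ℝ) ≤ k := by exact_mod_cast hk
  unfold invPow
  positivity

lemma abs_intCast_inv_le_one (k : ℤ) : |(k : ℝ)⁻¹| ≤ 1 := by
  rcases eq_or_ne k 0 with rfl | hk
  · simp
  · rw [abs_inv]
    apply inv_le_one_of_one_le₀
    exact_mod_cast Int.one_le_abs hk

lemma abs_invPow_le_of_le {a b : ℕ} (h : a ≤ b) (k : ℤ) : |invPow b k| ≤ |invPow a k| := by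
  simp only [invPow, abs_pow]
  exact pow_le_pow_of_le_one (abs_nonneg _) (abs_intCast_inv_le_one k) h

lemma abs_invPow_sub_le (n : ℕ) (k l : ℤ) :
    |invPow n k - invPow n l| ≤ n * |(k : ℝ)⁻¹ - (l : ℝ)⁻¹| := by
  refine (abs_pow_sub_pow_le ..).trans ?_
  have h : max |(k : ℝ)⁻¹| |(l : ℝ)⁻¹| ^ (n - 1) ≤ 1 :=
    pow_le_one₀ (le_max_of_le_left (abs_nonneg _))
      (max_le (abs_intCast_inv_le_one k) (abs_intCast_inv_le_one l))
  have h' : 0 ≤ |(k : ℝ)⁻¹ - (l : ℝ)⁻¹| * n := by positivity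
  nlinarith [mul_le_mul_of_nonneg_left h h']

/-- Away from the poles (1/(j+p) - 1/p)/j = -1/((j+p)p), and a product is bounded by the sum of
squares. The factor 1/j thus buys quadratic decay in p even for n = 1. With 0⁻¹ = 0 the bound
survives at j = 0, p = 0 and j + p = 0. -/
lemma abs_invPow_add_sub_mul_le (n : ℕ) (j p : ℤ) :
    |invPow n (j + p) - invPow n p| * |(j : ℝ)⁻¹| ≤ n * (invPow 2 (j + p) + invPow 2 p) := by
  have key : |((j + p : ℤ) : ℝ)⁻¹ - (p : ℝ)⁻¹| * |(j : ℝ)⁻¹| ≤ invPow 2 (j + p) + invPow 2 p := by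
    unfold invPow
    rcases eq_or_ne j 0 with rfl | hj
    · simp; positivity
    rcases eq_or_ne p 0 with rfl | hp
    · simp [← sq]
    rcases eq_or_ne (j + p) 0 with h | h
    · rw [h, show j = -p by omega]
      simp [← sq]
    · have hj' : (j : ℝ) ≠ 0 := by exact_mod_cast hj
      have hp' : (p : ℝ) ≠ 0 := by exact_mod_cast hp
      have h' : ((j + p : ℤ) : ℝ) ≠ 0 := by exact_mod_cast h
      have : (((j + p : ℤ) : ℝ)⁻¹ - (p : ℝ)⁻¹) * (j : ℝ)⁻¹
          = - (((j + p : ℤ) : ℝ)⁻¹ * (p : ℝ)⁻¹) := by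
        push_cast at h' ⊢
        field_simp
        ring
      rw [← abs_mul, this, abs_neg, abs_le]
      constructor <;> nlinarith [sq_nonneg (((j + p : ℤ) : ℝ)⁻¹ + (p : ℝ)⁻¹),
        sq_nonneg (((j + p : ℤ) : ℝ)⁻¹ - (p : ℝ)⁻¹), sq_nonneg (((j + p : ℤ) : ℝ)⁻¹),
        sq_nonneg ((p : ℝ)⁻¹)]
  calc _ ≤ n * |((j + p : ℤ) : ℝ)⁻¹ - (p : ℝ)⁻¹| * |(j : ℝ)⁻¹| := by
        gcongr; exact abs_invPow_sub_le ..
    _ ≤ _ := by rw [mul_assoc]; gcongr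

lemma summable_invPow {n : ℕ} (hn : 2 ≤ n) : Summable (invPow n) := by
  have := (Real.summable_one_div_int_pow (p := n)).2 (by omega)
  exact this.congr fun k => by simp [invPow]

/-- The preceding bound applies with the fixed shift d in the role of j; dividing by |d⁻¹| costs
only a constant. -/
lemma summable_invPow_add_sub (n : ℕ) (d : ℤ) :
    Summable fun j : ℤ => invPow n (j + d) - invPow n j := by
  rcases eq_or_ne d 0 with rfl | hd
  · simp
  have hs := summable_invPow le_rfl
  have hs' : Summable fun j : ℤ => invPow 2 (d + j) :=
    (Equiv.addLeft d).summable_iff.2 hs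
  refine Summable.of_norm_bounded (((hs'.add hs).mul_left (n : ℝ)).mul_left |(d : ℝ)|) fun j => ?_
  have hd' : |(d : ℝ)| ≠ 0 := by simpa using hd
  have h := mul_le_mul_of_nonneg_left (abs_invPow_add_sub_mul_le n d j) (abs_nonneg (d : ℝ))
  rw [Real.norm_eq_abs, add_comm j d]
  refine le_trans (le_of_eq ?_) h
  rw [abs_inv]
  field_simp

lemma tendsto_invPow_cofinite {n : ℕ} (hn : 1 ≤ n) : Tendsto (invPow n) cofinite (𝓝 0) := by
  have h1 : Tendsto (fun k : ℤ => (k : ℝ)⁻¹) cofinite (𝓝 0) := by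
    have := (summable_invPow le_rfl).tendsto_cofinite_zero.sqrt
    simp only [invPow, Real.sqrt_sq_eq_abs, Real.sqrt_zero] at this
    exact (tendsto_zero_iff_abs_tendsto_zero _).2 this
  have := h1.pow n
  rwa [zero_pow (by omega)] at this

/-! ### Telescoping and symmetric sums over the integers -/

lemma hasSum_nat_telescoping {a : ℕ → ℝ} (ha : Tendsto a atTop (𝓝 0))
    (hs : Summable fun p => a (p + 1) - a p) : HasSum (fun p => a (p + 1) - a p) (-a 0) := by
  rw [hs.hasSum_iff_tendsto_nat]
  simp only [Finset.sum_range_sub]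
  simpa using ha.sub_const (a 0)

/-- For d = 1 the two half-lines telescope to -g 0 and g 0; a general d follows by adding or
removing translated unit shifts. Only decay of g is used, not summability. -/
lemma hasSum_int_add_sub {g : ℤ → ℝ} (hg : Tendsto g cofinite (𝓝 0))
    (hs : Summable fun j => g (j + 1) - g j) (d : ℤ) : HasSum (fun j => g (j + d) - g j) 0 := by
  have h1 : HasSum (fun j => g (j + 1) - g j) 0 := by
    have hpos : HasSum (fun n : ℕ => g ((n : ℤ) + 1) - g n) (-g 0) := by
      have := hasSum_nat_telescoping (a := fun n : ℕ => g n)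
        (hg.comp (Nat.cofinite_eq_atTop ▸ (Nat.cast_injective (R := ℤ)).tendsto_cofinite))
        ((hs.comp_injective (Nat.cast_injective (R := ℤ))).congr fun n => by simp)
      simpa using this
    have hinj : Function.Injective fun n : ℕ => -(n : ℤ) := fun a b h => by simpa using h
    have hinj' : Function.Injective fun n : ℕ => -((n : ℤ) + 1) := fun a b h => by
      simpa using h
    have hneg : HasSum (fun n : ℕ => g (-((n : ℤ) + 1) + 1) - g (-((n : ℤ) + 1))) (g 0) := by
      have := (hasSum_nat_telescoping (a := fun n : ℕ => g (-(n : ℤ)))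
        (hg.comp (Nat.cofinite_eq_atTop ▸ hinj.tendsto_cofinite))
        ((hs.comp_injective hinj').neg.congr fun n => by simp)).neg
      simpa using this
    simpa using hpos.of_nat_of_neg_add_one (f := fun j => g (j + 1) - g j) hneg
  have h1' (d : ℤ) : HasSum (fun j => g (j + d + 1) - g (j + d)) 0 :=
    (Equiv.addRight d).hasSum_iff.2 h1
  induction d using Int.induction_on with
  | zero => simp
  | succ d ih =>
    have := (h1' d).add ih
    rw [add_zero] at this
    convert this using 1
    ext j
    ring_nf
  | pred d ih =>
    have := ih.sub (h1' (-d - 1))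
    rw [sub_zero] at this
    refine (funext fun j => ?_ : (fun j => g (j + (-(d : ℤ) - 1)) - g j) = _) ▸ this
    rw [show j + (-(d : ℤ) - 1) + 1 = j + -d by ring]
    ring

lemma hasSum_invPow_add_sub {n : ℕ} (hn : 1 ≤ n) (d : ℤ) :
    HasSum (fun j => invPow n (j + d) - invPow n j) 0 :=
  hasSum_int_add_sub (tendsto_invPow_cofinite hn) (summable_invPow_add_sub n 1) d

lemma tendsto_Icc_neg_atTop : Tendsto (fun N : ℕ => Icc (-(N : ℤ)) N) atTop atTop := by
  refine tendsto_atTop_finset_of_monotone (fun a b h => Icc_subset_Icc (by omega) (by omega))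
    fun k => ⟨k.natAbs, ?_⟩
  rw [mem_Icc]
  omega

lemma HasSum.tendsto_sum_Icc_neg {f : ℤ → ℝ} {a : ℝ} (h : HasSum f a) :
    Tendsto (fun N : ℕ => ∑ k ∈ Icc (-(N : ℤ)) N, f k) atTop (𝓝 a) :=
  Tendsto.comp (g := fun s => ∑ k ∈ s, f k) (by simpa [HasSum] using h) tendsto_Icc_neg_atTop

lemma sum_Icc_neg_eq_zero {f : ℤ → ℝ} (hf : ∀ k, f (-k) = - f k) (N : ℕ) :
    ∑ k ∈ Icc (-(N : ℤ)) N, f k = 0 := by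
  have : ∑ k ∈ Icc (-(N : ℤ)) N, f k = ∑ k ∈ Icc (-(N : ℤ)) N, f (-k) := by
    apply Finset.sum_nbij' (fun k => -k) (fun k => -k) <;> simp <;> omega
  simp only [hf, Finset.sum_neg_distrib] at this
  linarith

/-! ### Multiple zeta values as convergent sums over gaps -/

lemma pnat_injective_cast : Function.Injective fun k : ℕ+ => ((k : ℕ) : ℤ) :=
  fun a b h => by simpa using h

lemma strictMono_fin_two {x y : ℕ} (h : x < y) : StrictMono ![x, y] := by
  intro i j hij
  fin_cases i <;> fin_cases j <;> simp_all

lemma strictMono_fin_three {x y z : ℕ} (h : x < y) (h' : y < z) : StrictMono ![x, y, z] := by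
  intro i j hij
  fin_cases i <;> fin_cases j <;> simp_all
  omega

/-- Positive integers are the increasing sequences of length one. -/
def mzvIndexOne : ℕ+ ≃ MZVIndex 1 :=
  Equiv.ofBijective
    (fun k => ⟨![(k : ℕ)], fun i => by fin_cases i; simp, Subsingleton.strictMono _⟩) <| by
    constructor
    · intro a b h
      have := congr_fun (congr_arg Subtype.val h) 0
      simpa using this
    · rintro ⟨k, hk, hk'⟩
      refine ⟨⟨k 0, hk 0⟩, Subtype.ext (funext fun i => ?_)⟩
      fin_cases i
      simp

/-- Increasing sequences of length two, by their first term and their gap. -/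
def mzvIndexTwo : ℕ+ × ℕ+ ≃ MZVIndex 2 :=
  Equiv.ofBijective
    (fun k => ⟨![(k.1 : ℕ), k.1 + k.2], fun i => by fin_cases i <;> simp,
      strictMono_fin_two (by simp)⟩) <| by
    constructor
    · rintro ⟨a, a'⟩ ⟨b, b'⟩ h
      have h0 := congr_fun (congr_arg Subtype.val h) 0
      have h1 := congr_fun (congr_arg Subtype.val h) 1
      simp only [Matrix.cons_val_zero, Matrix.cons_val_one] at h0 h1
      obtain rfl : a = b := PNat.coe_injective h0
      obtain rfl : a' = b' := PNat.coe_injective (by omega)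
      rfl
    · rintro ⟨k, hk, hk'⟩
      have h01 : k 0 < k 1 := hk' (by simp)
      refine ⟨(⟨k 0, hk 0⟩, ⟨k 1 - k 0, by omega⟩), Subtype.ext (funext fun i => ?_)⟩
      fin_cases i
      · simp
      · simp; omega

/-- Increasing sequences of length three, by their first term and their gaps. -/
def mzvIndexThree : ℕ+ × ℕ+ × ℕ+ ≃ MZVIndex 3 :=
  Equiv.ofBijective
    (fun k => ⟨![(k.1 : ℕ), k.1 + k.2.1, k.1 + k.2.1 + k.2.2],
      fun i => by fin_cases i <;> simp,
      strictMono_fin_three (by simp) (by simp)⟩) <| by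
    constructor
    · rintro ⟨a, a', a''⟩ ⟨b, b', b''⟩ h
      have h0 := congr_fun (congr_arg Subtype.val h) 0
      have h1 := congr_fun (congr_arg Subtype.val h) 1
      have h2 := congr_fun (congr_arg Subtype.val h) 2
      simp only [Matrix.cons_val_zero, Matrix.cons_val_one, Matrix.cons_val] at h0 h1 h2
      obtain rfl : a = b := PNat.coe_injective h0
      obtain rfl : a' = b' := PNat.coe_injective (by omega)
      obtain rfl : a'' = b'' := PNat.coe_injective (by omega)
      rfl
    · rintro ⟨k, hk, hk'⟩
      have h01 : k 0 < k 1 := hk' (by simp)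
      have h12 : k 1 < k 2 := hk' (by simp)
      refine ⟨(⟨k 0, hk 0⟩, ⟨k 1 - k 0, by omega⟩, ⟨k 2 - k 1, by omega⟩),
        Subtype.ext (funext fun i => ?_)⟩
      fin_cases i
      · simp
      · simp; omega
      · simp; omega

lemma mzvTerm_mzvIndexOne (n : ℕ) (k : ℕ+) :
    mzvTerm ![n] (mzvIndexOne k) = invPow n k := by
  change 1 / ∏ i, ((![(k : ℕ)] i : ℕ) : ℝ) ^ ![n] i = _
  simp [invPow]

lemma mzvTerm_mzvIndexTwo (a b : ℕ) (k : ℕ+ × ℕ+) :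
    mzvTerm ![a, b] (mzvIndexTwo k) = invPow a k.1 * invPow b (k.1 + k.2) := by
  change 1 / ∏ i, ((![(k.1 : ℕ), k.1 + k.2] i : ℕ) : ℝ) ^ ![a, b] i = _
  simp [invPow, mul_comm]

lemma mzvTerm_mzvIndexThree (a b c : ℕ) (k : ℕ+ × ℕ+ × ℕ+) :
    mzvTerm ![a, b, c] (mzvIndexThree k)
      = invPow a k.1 * invPow b (k.1 + k.2.1) * invPow c (k.1 + k.2.1 + k.2.2) := by
  change 1 / ∏ i, ((![(k.1 : ℕ), k.1 + k.2.1, k.1 + k.2.1 + k.2.2] i : ℕ) : ℝ)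
    ^ ![a, b, c] i = _
  simp [invPow, Fin.prod_univ_three]
  ring

lemma summable_pnat_rpow {s : ℝ} (hs : s < -1) : Summable fun k : ℕ+ => (k : ℝ) ^ s :=
  (Real.summable_nat_rpow.2 hs).comp_injective PNat.coe_injective

lemma invPow_pnat_le {a n : ℕ} (ha : a ≤ n) (k : ℕ+) : invPow n k ≤ ((k : ℝ) ^ (a : ℝ))⁻¹ := by
  have h1 : (1 : ℝ) ≤ k := Nat.one_le_cast.2 k.pos
  have : invPow n k = ((k : ℝ) ^ n)⁻¹ := by simp [invPow]
  rw [this, Real.rpow_natCast]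
  gcongr

lemma pnat_rpow_mono {k l : ℕ+} {s t : ℝ} (hs : 0 ≤ s) (hkl : k ≤ l) (hst : s ≤ t) :
    (k : ℝ) ^ s ≤ (l : ℝ) ^ t := by
  have h1 : (1 : ℝ) ≤ l := Nat.one_le_cast.2 l.pos
  have h2 : (k : ℝ) ≤ l := by exact_mod_cast hkl
  calc _ ≤ (l : ℝ) ^ s := Real.rpow_le_rpow (by positivity) h2 hs
    _ ≤ _ := Real.rpow_le_rpow_of_exponent_le h1 hst

lemma pnat_rpow_pos (k : ℕ+) (s : ℝ) : 0 < (k : ℝ) ^ s :=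
  Real.rpow_pos_of_pos (by exact_mod_cast k.pos) s

lemma pnat_rpow_add (k : ℕ+) (s t : ℝ) : (k : ℝ) ^ (s + t) = (k : ℝ) ^ s * (k : ℝ) ^ t :=
  Real.rpow_add (by exact_mod_cast k.pos) s t

/-- (p+q)² = (p+q)^(1/4) (p+q)^(7/4) ≥ p^(1/4) q^(5/4): moving a quarter power to the harmonic
factor leaves exponent 5/4 on both variables. -/
lemma summable_invPow_two {a b : ℕ} (ha : 1 ≤ a) (hb : 2 ≤ b) :
    Summable fun k : ℕ+ × ℕ+ => invPow a k.1 * invPow b (k.1 + k.2) := by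
  have hs := summable_pnat_rpow (s := -(5 / 4)) (by norm_num)
  refine Summable.of_nonneg_of_le (fun k => ?_) (fun k => ?_)
    (hs.mul_of_nonneg hs (fun k => (pnat_rpow_pos k _).le) fun k => (pnat_rpow_pos k _).le)
  · exact mul_nonneg (invPow_nonneg_of_nonneg _ (by positivity))
      (invPow_nonneg_of_nonneg _ (by positivity))
  obtain ⟨p, q⟩ := k
  have h1 := invPow_pnat_le ha p
  have h2 := invPow_pnat_le hb (p + q)
  push_cast at h1 h2
  have e1 := pnat_rpow_mono (s := 1 / 4) (t := 1 / 4) (k := p) (l := p + q) (by norm_num)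
    (PNat.lt_add_right p q).le le_rfl
  have e2 := pnat_rpow_mono (s := 5 / 4) (t := 7 / 4) (k := q) (l := p + q) (by norm_num)
    (PNat.lt_add_left q p).le (by norm_num)
  have e3 := pnat_rpow_add (p + q) (1 / 4) (7 / 4)
  have e4 := pnat_rpow_add p 1 (1 / 4)
  norm_num at e3 e4 e1 e2
  simp only
  rw [Real.rpow_neg (by positivity), Real.rpow_neg (by positivity), e4]
  calc _ ≤ ((p : ℝ) ^ (1 : ℝ))⁻¹ * (((p : ℝ) + q) ^ (2 : ℝ))⁻¹ := by
        gcongr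
        · exact invPow_nonneg_of_nonneg _ (by positivity)
    _ ≤ ((p : ℝ) ^ (1 : ℝ))⁻¹ * (((p : ℝ) ^ (1 / 4 : ℝ)) * (q : ℝ) ^ (5 / 4 : ℝ))⁻¹ := by
        have := pnat_rpow_pos p (1 / 4)
        have := pnat_rpow_pos q (5 / 4)
        gcongr
        rw [Real.rpow_two, e3]
        gcongr
    _ = _ := by simp only [mul_inv, Real.rpow_one]; ring

/-- The same trade: (p+q)⁻¹ ≤ q⁻¹, and the square of p+q+r is split with exponents 1/4, 1/4 and 3/2.
-/
lemma summable_invPow_three {a b c : ℕ} (ha : 1 ≤ a) (hb : 1 ≤ b) (hc : 2 ≤ c) :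
    Summable fun k : ℕ+ × ℕ+ × ℕ+ =>
      invPow a k.1 * invPow b (k.1 + k.2.1) * invPow c (k.1 + k.2.1 + k.2.2) := by
  have hs := summable_pnat_rpow (s := -(5 / 4)) (by norm_num)
  have hs2 := hs.mul_of_nonneg hs (fun k => (pnat_rpow_pos k _).le)
    fun k => (pnat_rpow_pos k _).le
  refine Summable.of_nonneg_of_le (fun k => ?_) (fun k => ?_)
    (hs.mul_of_nonneg hs2 (fun k => (pnat_rpow_pos k _).le)
      fun k => (mul_pos (pnat_rpow_pos k.1 _) (pnat_rpow_pos k.2 _)).le)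
  · exact mul_nonneg (mul_nonneg (invPow_nonneg_of_nonneg _ (by positivity))
      (invPow_nonneg_of_nonneg _ (by positivity))) (invPow_nonneg_of_nonneg _ (by positivity))
  obtain ⟨p, q, r⟩ := k
  have h1 := invPow_pnat_le ha p
  have h2 := invPow_pnat_le hb (p + q)
  have h3 := invPow_pnat_le hc (p + q + r)
  push_cast at h1 h2 h3
  have e0 := pnat_rpow_mono (s := 1) (t := 1) (k := q) (l := p + q) (by norm_num)
    (PNat.lt_add_left q p).le le_rfl
  have e1 := pnat_rpow_mono (s := 1 / 4) (t := 1 / 4) (k := p) (l := p + q + r) (by norm_num)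
    ((PNat.lt_add_right p q).trans (PNat.lt_add_right _ r)).le le_rfl
  have e1' := pnat_rpow_mono (s := 1 / 4) (t := 1 / 4) (k := q) (l := p + q + r) (by norm_num)
    ((PNat.lt_add_left q p).trans (PNat.lt_add_right _ r)).le le_rfl
  have e2 := pnat_rpow_mono (s := 5 / 4) (t := 3 / 2) (k := r) (l := p + q + r) (by norm_num)
    (PNat.lt_add_left r _).le (by norm_num)
  have e3 := pnat_rpow_add (p + q + r) (1 / 4 + 1 / 4) (3 / 2)
  rw [pnat_rpow_add _ (1 / 4) (1 / 4)] at e3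
  have e4 := pnat_rpow_add p 1 (1 / 4)
  have e5 := pnat_rpow_add q 1 (1 / 4)
  norm_num at e0 e3 e4 e5 e1 e1' e2 h1 h2
  simp only
  rw [Real.rpow_neg (by positivity), Real.rpow_neg (by positivity),
    Real.rpow_neg (by positivity), e4, e5]
  have := pnat_rpow_pos p (1 / 4)
  have := pnat_rpow_pos q (1 / 4)
  have := pnat_rpow_pos r (5 / 4)
  have hn := invPow_nonneg_of_nonneg c (k := (p : ℤ) + q + r) (by positivity)
  have hn' := invPow_nonneg_of_nonneg b (k := (p : ℤ) + q) (by positivity)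
  calc _ ≤ (p : ℝ)⁻¹ * ((p : ℝ) + q)⁻¹ * (((p : ℝ) + q + r) ^ (2 : ℝ))⁻¹ := by
        gcongr
    _ ≤ (p : ℝ)⁻¹ * (q : ℝ)⁻¹ *
        ((p : ℝ) ^ (1 / 4 : ℝ) * (q : ℝ) ^ (1 / 4 : ℝ) * (r : ℝ) ^ (5 / 4 : ℝ))⁻¹ := by
        have hq : (0 : ℝ) < q := by exact_mod_cast q.pos
        gcongr
        · linarith [show (0 : ℝ) < p by exact_mod_cast p.pos]
        · rw [Real.rpow_two, e3]
          gcongr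
    _ = _ := by simp only [mul_inv]; ring

lemma hasSum_mzv_one {n : ℕ} (hn : 2 ≤ n) :
    HasSum (fun k : ℕ+ => invPow n k) (mzv ![n]) := by
  have hs : Summable fun k : ℕ+ => invPow n k :=
    (summable_invPow hn).comp_injective pnat_injective_cast
  have := hs.hasSum
  rwa [mzv, ← mzvIndexOne.tsum_eq, tsum_congr (mzvTerm_mzvIndexOne n)]

lemma hasSum_mzv_two {a b : ℕ} (ha : 1 ≤ a) (hb : 2 ≤ b) :
    HasSum (fun k : ℕ+ × ℕ+ => invPow a k.1 * invPow b (k.1 + k.2)) (mzv ![a, b]) := by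
  have := (summable_invPow_two ha hb).hasSum
  rwa [mzv, ← mzvIndexTwo.tsum_eq, tsum_congr (mzvTerm_mzvIndexTwo a b)]

lemma summable_mzvTerm_three {a b c : ℕ} (ha : 1 ≤ a) (hb : 1 ≤ b) (hc : 2 ≤ c) :
    Summable (mzvTerm ![a, b, c]) := by
  rw [← mzvIndexThree.summable_iff]
  exact (summable_invPow_three ha hb hc).congr fun k => (mzvTerm_mzvIndexThree a b c k).symm

lemma hasSum_mzv_three {a b c : ℕ} (ha : 1 ≤ a) (hb : 1 ≤ b) (hc : 2 ≤ c) :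
    HasSum (fun k : ℕ+ × ℕ+ × ℕ+ =>
      invPow a k.1 * invPow b (k.1 + k.2.1) * invPow c (k.1 + k.2.1 + k.2.2))
      (mzv ![a, b, c]) := by
  have := (summable_invPow_three ha hb hc).hasSum
  rwa [mzv, ← mzvIndexThree.tsum_eq, tsum_congr (mzvTerm_mzvIndexThree a b c)]

/-! ### Summing out the smallest index -/

/-- The partial sum of the `n`-th powers of `1 / m` over `0 < m < j`. -/
def harmonicBelow (n j : ℕ) : ℝ := ∑ m ∈ range j, invPow n m

lemma harmonicBelow_succ (n j : ℕ) :
    harmonicBelow n (j + 1) = harmonicBelow n j + invPow n j :=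
  Finset.sum_range_succ ..

/-- With j the first term plus the first gap, the sum over first terms m < j is finite. The index m
= 0 in `harmonicBelow` is harmless because n ≥ 1. -/
lemma HasSum.harmonicBelow_mul {β : Type*} {n : ℕ} (hn : 1 ≤ n) {φ : ℕ+ → β → ℝ} {S : ℝ}
    (h : HasSum (fun x : ℕ+ × ℕ+ × β => invPow n x.1 * φ (x.1 + x.2.1) x.2.2) S) :
    HasSum (fun x : ℕ+ × β => harmonicBelow n x.1 * φ x.1 x.2) S := by
  let i : ℕ+ × ℕ+ × β → (ℕ+ × β) × ℕ+ := fun x => ((x.1 + x.2.1, x.2.2), x.1)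
  have hi : Function.Injective i := by
    rintro ⟨a, b, c⟩ ⟨a', b', c'⟩ h
    simp only [i, Prod.mk.injEq] at h
    obtain ⟨⟨h1, rfl⟩, rfl⟩ := h
    rw [add_right_inj] at h1
    rw [h1]
  have key : HasSum (fun x : (ℕ+ × β) × ℕ+ =>
      if x.2 < x.1.1 then invPow n x.2 * φ x.1.1 x.1.2 else 0) S := by
    rw [← hi.hasSum_iff]
    · refine Eq.mp (congr_arg (HasSum · S) (funext fun x => ?_)) h
      simp [i, PNat.lt_add_right]
    · rintro ⟨⟨j, y⟩, m⟩ hx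
      rw [if_neg]
      intro hlt
      refine hx ⟨(m, j - m, y), ?_⟩
      simp only [i]
      rw [PNat.add_sub_of_lt hlt]
  refine key.prod_fiberwise fun x => ?_
  have h2 : HasSum (fun m : ℕ => if m < x.1 then invPow n m * φ x.1 x.2 else 0)
      (harmonicBelow n x.1 * φ x.1 x.2) := by
    rw [harmonicBelow, Finset.sum_mul]
    convert hasSum_sum_of_ne_finset_zero (f := fun m : ℕ =>
      if m < (x.1 : ℕ) then invPow n m * φ x.1 x.2 else 0) (s := range x.1) ?_ using 1
    · exact Finset.sum_congr rfl fun m hm => by rw [if_pos (mem_range.1 hm)]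
    · intro m hm
      rw [if_neg (by simpa using hm)]
    · infer_instance
  have h3 := (hasSum_pnat_iff (f := fun m : ℕ =>
    if m < (x.1 : ℕ) then invPow n m * φ x.1 x.2 else 0)
    (a := harmonicBelow n x.1 * φ x.1 x.2)).2 (by simpa [invPow_zero_right hn] using h2)
  simpa using h3

/-! ### Cotangent summation of rational functions -/

/-- The Laurent polynomial `X + α`. -/
def shiftedX (α : ℝ) : LaurentSeries ℝ := HahnSeries.single 1 1 + HahnSeries.C α

lemma shiftedX_zero : shiftedX 0 = HahnSeries.single 1 1 := by simp [shiftedX]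

lemma shiftedX_eq_coe (α : ℝ) :
    shiftedX α = ((PowerSeries.X + PowerSeries.C α : PowerSeries ℝ) : LaurentSeries ℝ) := by
  simp [shiftedX]

lemma shiftedX_ne_zero (α : ℝ) : shiftedX α ≠ 0 := by
  intro h
  have := congr_arg (fun f => HahnSeries.coeff f 1) h
  simp [shiftedX, HahnSeries.C_apply] at this

/-- The value at `k` of the rational function `∏ (t - c) ^ (-e c)`. -/
def lineTerm (S : Finset ℤ) (e : ℤ → ℕ) (k : ℤ) : ℝ := ∏ c ∈ S, invPow (e c) (k - c)

/-- The Laurent expansion of `∏ (t - c) ^ (-e c)` at `t = c`. -/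
def lineExpansion (S : Finset ℤ) (e : ℤ → ℕ) (c : ℤ) : LaurentSeries ℝ :=
  ∏ c' ∈ S, (shiftedX ((c : ℝ) - c'))⁻¹ ^ e c'

lemma prod_pow_add_single {M : Type*} [CommMonoid M] {S : Finset ℤ} {a : ℤ} (ha : a ∈ S)
    (x : ℤ → M) (e : ℤ → ℕ) :
    ∏ c ∈ S, x c ^ (e + Pi.single a 1 : ℤ → ℕ) c = (∏ c ∈ S, x c ^ e c) * x a := by
  simp only [Pi.add_apply, pow_add, Finset.prod_mul_distrib]
  congr 1
  rw [Finset.prod_eq_single a]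
  · simp
  · intro b _ hb
    simp [hb]
  · exact fun h => absurd ha h

lemma inv_mul_inv_eq_of_sub_eq {F : Type*} [Field F] {x y d : F} (hx : x ≠ 0) (hy : y ≠ 0)
    (hd : d ≠ 0) (h : y - x = d) : x⁻¹ * y⁻¹ = d⁻¹ * (x⁻¹ - y⁻¹) := by
  subst h
  field_simp

/-- Partial fractions at two distinct poles. Laurent expansions obey the same identity, so the sum
and its residue side satisfy one recursion. -/
lemma lineTerm_add_single_add_single {S : Finset ℤ} {a b : ℤ} (ha : a ∈ S) (hb : b ∈ S)
    (hab : a ≠ b) (e : ℤ → ℕ) {k : ℤ} (hk : k ∉ S) :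
    lineTerm S (e + Pi.single a 1 + Pi.single b 1) k
      = ((a : ℝ) - b)⁻¹ *
        (lineTerm S (e + Pi.single a 1) k - lineTerm S (e + Pi.single b 1) k) := by
  simp only [lineTerm, invPow]
  rw [prod_pow_add_single hb (fun c => ((k - c : ℤ) : ℝ)⁻¹), prod_pow_add_single ha (fun c => ((k - c : ℤ) : ℝ)⁻¹),
    prod_pow_add_single hb (fun c => ((k - c : ℤ) : ℝ)⁻¹), mul_assoc,
    inv_mul_inv_eq_of_sub_eq (d := (a : ℝ) - b)]
  · ring
  · exact_mod_cast sub_ne_zero.2 fun h : k = a => hk (h ▸ ha)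
  · exact_mod_cast sub_ne_zero.2 fun h : k = b => hk (h ▸ hb)
  · exact sub_ne_zero.2 (by exact_mod_cast hab)
  · push_cast; ring

lemma lineExpansion_add_single_add_single {S : Finset ℤ} {a b : ℤ} (ha : a ∈ S) (hb : b ∈ S)
    (hab : a ≠ b) (e : ℤ → ℕ) (c : ℤ) :
    lineExpansion S (e + Pi.single a 1 + Pi.single b 1) c
      = ((a : ℝ) - b)⁻¹ •
        (lineExpansion S (e + Pi.single a 1) c - lineExpansion S (e + Pi.single b 1) c) := by
  have hab' : (a : ℝ) - b ≠ 0 := sub_ne_zero.2 (by exact_mod_cast hab)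
  simp only [lineExpansion]
  rw [← HahnSeries.C_mul_eq_smul, prod_pow_add_single hb, prod_pow_add_single ha, prod_pow_add_single hb, mul_assoc,
    inv_mul_inv_eq_of_sub_eq (d := HahnSeries.C ((a : ℝ) - b)) (shiftedX_ne_zero _)
      (shiftedX_ne_zero _), map_inv₀]
  · ring
  · exact (map_ne_zero _).2 hab'
  · simp only [shiftedX, map_sub]
    ring

/-- The sum of the residues of `-π cot (π t) / 2 * ∏ (t - c) ^ (-e c)` at the points of `S`. -/
def residueSum (W : ℕ) (S : Finset ℤ) (e : ℤ → ℕ) : ℝ :=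
  ∑ c ∈ S, ∑ s ∈ range (W + 1), evenZeta s * (lineExpansion S e c).coeff (-(2 * s : ℤ))

lemma residueSum_add_single_add_single (W : ℕ) {S : Finset ℤ} {a b : ℤ} (ha : a ∈ S)
    (hb : b ∈ S) (hab : a ≠ b) (e : ℤ → ℕ) :
    residueSum W S (e + Pi.single a 1 + Pi.single b 1)
      = ((a : ℝ) - b)⁻¹ *
        (residueSum W S (e + Pi.single a 1) - residueSum W S (e + Pi.single b 1)) := by
  simp only [residueSum, ← Finset.sum_sub_distrib, Finset.mul_sum]
  refine Finset.sum_congr rfl fun c _ => Finset.sum_congr rfl fun s _ => ?_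
  rw [lineExpansion_add_single_add_single ha hb hab]
  simp only [HahnSeries.coeff_smul, HahnSeries.coeff_sub, smul_eq_mul]
  ring

/-- The symmetric sum of `k ^ (-n)` over the nonzero integers. -/
def twoSidedZeta (n : ℕ) : ℝ := if Even n then 2 * mzv ![n] else 0

lemma hasSum_int_invPow {n : ℕ} (hn : 2 ≤ n) : HasSum (invPow n) (twoSidedZeta n) := by
  have h1 := hasSum_mzv_one hn
  have h2 : HasSum (fun k : ℕ => invPow n ((k : ℤ) + 1)) (mzv ![n]) := by
    have := (hasSum_pnat_iff_hasSum_succ (f := fun k : ℕ => invPow n k)).1 h1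
    simpa using this
  have h3 : HasSum (fun k : ℕ => invPow n (-((k : ℤ) + 1))) ((-1) ^ n * mzv ![n]) := by
    simp only [invPow_neg]
    exact h2.mul_left _
  have := h2.of_add_one_of_neg_add_one h3
  rw [invPow_zero_right (by omega), add_zero] at this
  rw [twoSidedZeta]
  split_ifs with he
  · rw [he.neg_one_pow] at this
    convert this using 1
    ring
  · rw [(Nat.not_even_iff_odd.1 he).neg_one_pow] at this
    convert this using 1
    ring

lemma tendsto_sum_Icc_invPow {n : ℕ} (hn : 1 ≤ n) :
    Tendsto (fun N : ℕ => ∑ k ∈ Icc (-(N : ℤ)) N, invPow n k) atTop (𝓝 (twoSidedZeta n)) := by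
  by_cases he : Even n
  · obtain ⟨m, rfl⟩ := he
    exact (hasSum_int_invPow (by omega)).tendsto_sum_Icc_neg
  · rw [twoSidedZeta, if_neg he]
    refine tendsto_const_nhds.congr fun N => (sum_Icc_neg_eq_zero (fun k => ?_) N).symm
    rw [invPow_neg, (Nat.not_even_iff_odd.1 he).neg_one_pow]
    ring

/-- For n = 1 the series converges only conditionally; recentring the window is allowed because the
shifted difference is summable with sum 0. -/
lemma tendsto_sum_Icc_invPow_sub {n : ℕ} (hn : 1 ≤ n) (c : ℤ) :
    Tendsto (fun N : ℕ => ∑ k ∈ Icc (-(N : ℤ)) N, invPow n (k - c)) atTop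
      (𝓝 (twoSidedZeta n)) := by
  have := (tendsto_sum_Icc_invPow hn).add (hasSum_invPow_add_sub hn (-c)).tendsto_sum_Icc_neg
  simpa [← Finset.sum_add_distrib, sub_eq_add_neg] using this

lemma shiftedX_inv_pow_coeff_of_ne {α : ℝ} (hα : α ≠ 0) (n s : ℕ) :
    ((shiftedX α)⁻¹ ^ n).coeff (-(2 * s : ℤ)) = if s = 0 then (α⁻¹) ^ n else 0 := by
  have h : shiftedX α * (((PowerSeries.X + PowerSeries.C α : PowerSeries ℝ)⁻¹ : PowerSeries ℝ) :
      LaurentSeries ℝ) = 1 := by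
    rw [shiftedX_eq_coe, ← PowerSeries.coe_mul, PowerSeries.mul_inv_cancel]
    · simp
    · simpa using hα
  rw [inv_eq_of_mul_eq_one_right h, ← map_pow, PowerSeries.coeff_coe]
  split_ifs with h1 h2 h2
  · omega
  · rfl
  · subst h2
    simp
  · omega

lemma shiftedX_zero_inv_pow (n : ℕ) :
    (shiftedX 0)⁻¹ ^ n = HahnSeries.single (-(n : ℤ)) 1 := by
  rw [shiftedX_zero, HahnSeries.inv_single, HahnSeries.single_pow]
  simp

lemma sum_evenZeta_mul_coeff_shiftedX_zero {n W : ℕ} (hn : 1 ≤ n) (hW : n ≤ W) :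
    2 * ∑ s ∈ range (W + 1), evenZeta s * ((shiftedX 0)⁻¹ ^ n).coeff (-(2 * s : ℤ))
      = twoSidedZeta n := by
  rw [shiftedX_zero_inv_pow, twoSidedZeta]
  split_ifs with he
  · obtain ⟨m, rfl⟩ := he
    rw [Finset.sum_eq_single m]
    · rw [show -(2 * m : ℤ) = -((m + m : ℕ) : ℤ) by push_cast; ring,
        HahnSeries.coeff_single_same, evenZeta, if_neg (by omega), two_mul m, mul_one]
    · intro s _ hs
      rw [HahnSeries.coeff_single_of_ne (by push_cast; omega), mul_zero]
    · intro h
      rw [mem_range] at h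
      omega
  · rw [Finset.sum_eq_zero, mul_zero]
    intro s _
    rw [HahnSeries.coeff_single_of_ne, mul_zero]
    intro h
    exact he ⟨s, by omega⟩

/-- At a regular point only s = 0 contributes, and ζ(0) = -1/2 turns it into minus the value there.
This is what deletes the point from the sum over ℤ. -/
lemma sum_evenZeta_mul_coeff_shiftedX {α : ℝ} (hα : α ≠ 0) (n W : ℕ) :
    2 * ∑ s ∈ range (W + 1), evenZeta s * ((shiftedX α)⁻¹ ^ n).coeff (-(2 * s : ℤ))
      = -(α⁻¹) ^ n := by
  simp only [shiftedX_inv_pow_coeff_of_ne hα]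
  simp [evenZeta]
  ring

lemma tendsto_lineTerm_single {W : ℕ} {S : Finset ℤ} {e : ℤ → ℕ} {a : ℤ} (ha : a ∈ S)
    (hea : 1 ≤ e a) (he : ∀ c ∈ S, c ≠ a → e c = 0) (hW : e a ≤ W) :
    Tendsto (fun N : ℕ => ∑ k ∈ Icc (-(N : ℤ)) N \ S, lineTerm S e k) atTop
      (𝓝 (2 * residueSum W S e)) := by
  have hterm (k : ℤ) : lineTerm S e k = invPow (e a) (k - a) := by
    rw [lineTerm, Finset.prod_eq_single a]
    · intro c hc hca
      rw [he c hc hca, invPow_zero_left]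
    · exact fun h => absurd ha h
  have hexp (c : ℤ) : lineExpansion S e c = (shiftedX ((c : ℝ) - a))⁻¹ ^ e a := by
    rw [lineExpansion, Finset.prod_eq_single a]
    · intro c hc hca
      rw [he c hc hca, pow_zero]
    · exact fun h => absurd ha h
  have hres : 2 * residueSum W S e
      = twoSidedZeta (e a) - ∑ c ∈ S, invPow (e a) (c - a) := by
    rw [residueSum, Finset.mul_sum]
    simp only [hexp]
    rw [← Finset.add_sum_erase _ _ ha, ← Finset.add_sum_erase S (fun c => invPow _ _) ha, sub_self, sub_self,
      invPow_zero_right hea, zero_add, sum_evenZeta_mul_coeff_shiftedX_zero hea hW,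
      sub_eq_add_neg, ← Finset.sum_neg_distrib]
    congr 1
    refine Finset.sum_congr rfl fun c hc => ?_
    rw [sum_evenZeta_mul_coeff_shiftedX, invPow]
    · push_cast; rfl
    · exact sub_ne_zero.2 (by exact_mod_cast (mem_erase.1 hc).1)
  rw [hres]
  refine ((tendsto_sum_Icc_invPow_sub hea a).sub_const _).congr' ?_
  filter_upwards [tendsto_Icc_neg_atTop.eventually_ge_atTop S] with N hN
  simp only [hterm]
  rw [← Finset.sum_sdiff hN]
  ring

/-- Induction on the total order of the poles: two distinct poles are separated by partial
fractions, which lowers the order by one, and a single pole is the base case. The condition n ≤ W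
lets the range of s reach every polar coefficient. -/
lemma tendsto_lineTerm {W : ℕ} {S : Finset ℤ} (n : ℕ) : ∀ {e : ℤ → ℕ}, ∑ c ∈ S, e c = n →
    1 ≤ n → n ≤ W →
    Tendsto (fun N : ℕ => ∑ k ∈ Icc (-(N : ℤ)) N \ S, lineTerm S e k) atTop
      (𝓝 (2 * residueSum W S e)) := by
  induction n using Nat.strong_induction_on with
  | _ n ih =>
  intro e hen hn hW
  obtain ⟨a, ha, hea⟩ : ∃ a ∈ S, e a ≠ 0 := by
    by_contra! h
    rw [Finset.sum_eq_zero h] at hen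
    omega
  by_cases hb : ∃ b ∈ S, b ≠ a ∧ e b ≠ 0
  · obtain ⟨b, hb, hba, heb⟩ := hb
    obtain ⟨f, rfl⟩ : ∃ f : ℤ → ℕ, e = f + Pi.single a 1 + Pi.single b 1 := by
      refine ⟨e - Pi.single a 1 - Pi.single b 1, funext fun c => ?_⟩
      simp only [Pi.add_apply, Pi.sub_apply, Pi.single_apply]
      split_ifs with h1 h2 h2 <;> subst_vars <;> omega
    have hsum (d : ℤ) (hd : d ∈ S) : ∑ c ∈ S, (Pi.single d 1 : ℤ → ℕ) c = 1 := by
      simp [Pi.single_apply, hd]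
    simp only [Pi.add_apply, Finset.sum_add_distrib, hsum a ha, hsum b hb] at hen
    have h1 := ih (n - 1) (by omega) (e := f + Pi.single a 1)
      (by simp only [Pi.add_apply, Finset.sum_add_distrib, hsum a ha]; omega) (by omega) (by omega)
    have h2 := ih (n - 1) (by omega) (e := f + Pi.single b 1)
      (by simp only [Pi.add_apply, Finset.sum_add_distrib, hsum b hb]; omega) (by omega) (by omega)
    rw [residueSum_add_single_add_single W ha hb hba.symm]
    convert (h1.sub h2).const_mul ((a : ℝ) - b)⁻¹ using 2 with N
    · rw [← Finset.sum_sub_distrib, Finset.mul_sum]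
      exact Finset.sum_congr rfl fun k hk =>
        lineTerm_add_single_add_single ha hb hba.symm f (mem_sdiff.1 hk).2
    · ring
  · push Not at hb
    refine tendsto_lineTerm_single ha (by omega) hb (le_trans ?_ hW)
    rw [← hen]
    exact Finset.single_le_sum (fun _ _ => Nat.zero_le _) ha

/-! ### Laurent coefficients as sums of fixed weight -/

/-- The coefficient of `X ^ (μ - b)` in the power series `(X + α) ^ (-b)`. -/
def shiftedCoeff (b : ℕ) (α : ℝ) (μ : ℕ) : ℝ :=
  (-1) ^ (b + μ) * ((μ - 1).choose (b - 1) : ℝ) * α⁻¹ ^ μ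

/-- The negative binomial series for 1 - X, rescaled by X ↦ -α⁻¹X and multiplied by α^(-b). -/
lemma shiftedX_inv_pow_eq {α : ℝ} (hα : α ≠ 0) {b : ℕ} (hb : 1 ≤ b) :
    (shiftedX α)⁻¹ ^ b
      = ((PowerSeries.mk fun n => shiftedCoeff b α (b + n) : PowerSeries ℝ) :
        LaurentSeries ℝ) := by
  obtain ⟨d, rfl⟩ : ∃ d, b = d + 1 := ⟨b - 1, by omega⟩
  have h1 := congr_arg (PowerSeries.rescale (-α⁻¹))
    (PowerSeries.mk_add_choose_mul_one_sub_pow_eq_one (S := ℝ) d)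
  have h2 : PowerSeries.mk (fun n => shiftedCoeff (d + 1) α (d + 1 + n))
      = PowerSeries.C (α⁻¹ ^ (d + 1)) *
        PowerSeries.rescale (-α⁻¹) (PowerSeries.mk fun n => ((d + n).choose d : ℝ)) := by
    ext n
    rw [PowerSeries.coeff_C_mul, PowerSeries.coeff_rescale, PowerSeries.coeff_mk,
      PowerSeries.coeff_mk, shiftedCoeff, show d + 1 + n - 1 = d + n by omega,
      Nat.add_sub_cancel, ← add_assoc, pow_add (-1 : ℝ), ← two_mul, pow_mul]
    rw [neg_pow α⁻¹, pow_add α⁻¹]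
    ring
  have h3 : (PowerSeries.X + PowerSeries.C α : PowerSeries ℝ) ^ (d + 1)
      = PowerSeries.C (α ^ (d + 1)) * PowerSeries.rescale (-α⁻¹) ((1 - PowerSeries.X) ^ (d + 1)) := by
    rw [map_pow (PowerSeries.rescale _), map_sub, map_one, PowerSeries.rescale_X, map_pow, ← mul_pow]
    congr 1
    rw [map_neg, mul_sub, mul_one, neg_mul, mul_neg, ← mul_assoc, ← map_mul, mul_inv_cancel₀ hα, map_one]
    ring
  rw [inv_pow]
  refine inv_eq_of_mul_eq_one_right ?_
  rw [shiftedX_eq_coe, ← map_pow, ← PowerSeries.coe_mul, h2, h3]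
  rw [map_mul, map_one] at h1
  have h4 : (PowerSeries.C (α ^ (d + 1)) * PowerSeries.C (α⁻¹ ^ (d + 1)) : PowerSeries ℝ) = 1 := by
    rw [← map_mul, ← mul_pow, mul_inv_cancel₀ hα, one_pow, map_one]
  rw [mul_mul_mul_comm, h4, one_mul, mul_comm, h1, PowerSeries.coe_one]

lemma sum_Icc_ite_eq (b c w s : ℕ) (a : ℕ) (hw : w = a + b + c) (F : ℕ → ℕ → ℝ) :
    (∑ μ ∈ Icc b w, ∑ ν ∈ Icc c w, if μ + ν + 2 * s = w then F μ ν else 0)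
      = if 2 * s ≤ a then ∑ x ∈ antidiagonal (a - 2 * s), F (b + x.1) (c + x.2) else 0 := by
  rw [← Finset.sum_product', ← Finset.sum_filter]
  split_ifs with h
  · refine Finset.sum_nbij' (fun x => (x.1 - b, x.2 - c)) (fun x => (b + x.1, c + x.2)) ?_ ?_ ?_ ?_ ?_
    · simp only [mem_filter, mem_product, mem_Icc, HasAntidiagonal.mem_antidiagonal]
      omega
    · simp only [mem_filter, mem_product, mem_Icc, HasAntidiagonal.mem_antidiagonal]
      omega
    · simp only [mem_filter, mem_product, mem_Icc]
      intro x hx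
      ext <;> simp <;> omega
    · simp
    · simp only [mem_filter, mem_product, mem_Icc]
      intro x hx
      congr 1 <;> omega
  · apply Finset.sum_eq_zero
    simp only [mem_filter, mem_product, mem_Icc]
    omega

lemma coeff_shiftedX_zero_inv_pow_mul (a s : ℕ) (P : PowerSeries ℝ) :
    ((shiftedX 0)⁻¹ ^ a * (P : LaurentSeries ℝ)).coeff (-(2 * s : ℤ))
      = if 2 * s ≤ a then PowerSeries.coeff (a - 2 * s) P else 0 := by
  rw [shiftedX_zero_inv_pow, HahnSeries.coeff_single_mul, one_mul, PowerSeries.coeff_coe]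
  split_ifs with h1 h2 h2
  · omega
  · rfl
  · congr 2
    omega
  · omega

/-- The parameter c pads the weight to w, so that two-pole sums align with single layers of the
three-pole sums. -/
lemma coeff_shiftedX_two {α : ℝ} (hα : α ≠ 0) {a b c w s : ℕ} (hb : 1 ≤ b)
    (hw : w = a + b + c) :
    ((shiftedX 0)⁻¹ ^ a * (shiftedX α)⁻¹ ^ b).coeff (-(2 * s : ℤ))
      = ∑ μ ∈ Icc b w, if c + μ + 2 * s = w then shiftedCoeff b α μ else 0 := by
  rw [shiftedX_inv_pow_eq hα hb, coeff_shiftedX_zero_inv_pow_mul, PowerSeries.coeff_mk,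
    ← Finset.sum_filter]
  split_ifs with h
  · rw [Finset.sum_eq_single_of_mem (b + (a - 2 * s))]
    · simp only [mem_filter, mem_Icc]
      omega
    · simp only [mem_filter, mem_Icc]
      omega
  · symm
    apply Finset.sum_eq_zero
    simp only [mem_filter, mem_Icc]
    omega

/-- Since μ and ν are the exponents of α⁻¹ and β⁻¹, the exponent (μ-b) + (ν-c) - a of X equals -2s
exactly when μ + ν + 2s = w. -/
lemma coeff_shiftedX_three {α β : ℝ} (hα : α ≠ 0) (hβ : β ≠ 0) {a b c w s : ℕ} (hb : 1 ≤ b)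
    (hc : 1 ≤ c) (hw : w = a + b + c) :
    ((shiftedX 0)⁻¹ ^ a * ((shiftedX α)⁻¹ ^ b * (shiftedX β)⁻¹ ^ c)).coeff (-(2 * s : ℤ))
      = ∑ μ ∈ Icc b w, ∑ ν ∈ Icc c w,
        if μ + ν + 2 * s = w then shiftedCoeff b α μ * shiftedCoeff c β ν else 0 := by
  rw [shiftedX_inv_pow_eq hα hb, shiftedX_inv_pow_eq hβ hc, ← PowerSeries.coe_mul,
    coeff_shiftedX_zero_inv_pow_mul, sum_Icc_ite_eq b c w s a hw, PowerSeries.coeff_mul]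
  simp

lemma sum_mul_eq_weightSum (w b c : ℕ) (z : ℕ → ℝ) (F : ℕ → ℕ → ℝ) :
    ∑ s ∈ range (w + 1), z s * (∑ μ ∈ Icc b w, ∑ ν ∈ Icc c w,
      if μ + ν + 2 * s = w then F μ ν else 0)
      = weightSum w b c fun s μ ν => z s * F μ ν := by
  simp only [weightSum, Finset.mul_sum, mul_ite, mul_zero]
  rw [Finset.sum_comm]
  exact Finset.sum_congr rfl fun μ _ => Finset.sum_comm

lemma weightSum_congr {w a b : ℕ} {f g : ℕ → ℕ → ℕ → ℝ}
    (h : ∀ s μ ν, a ≤ μ → b ≤ ν → μ + ν + 2 * s = w → f s μ ν = g s μ ν) :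
    weightSum w a b f = weightSum w a b g := by
  refine Finset.sum_congr rfl fun μ hμ => Finset.sum_congr rfl fun ν hν =>
    Finset.sum_congr rfl fun s _ => ?_
  split_ifs with hw
  · exact h s μ ν (mem_Icc.1 hμ).1 (mem_Icc.1 hν).1 hw
  · rfl

lemma hasSum_weightSum {ι : Type*} {w a b : ℕ} {f : ι → ℕ → ℕ → ℕ → ℝ} {g : ℕ → ℕ → ℕ → ℝ}
    (h : ∀ s μ ν, a ≤ μ → b ≤ ν → μ + ν + 2 * s = w → HasSum (fun i => f i s μ ν) (g s μ ν)) :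
    HasSum (fun i => weightSum w a b (f i)) (weightSum w a b g) := by
  refine hasSum_sum fun μ hμ => hasSum_sum fun ν hν => hasSum_sum fun s _ => ?_
  split_ifs with hw
  · exact h s μ ν (mem_Icc.1 hμ).1 (mem_Icc.1 hν).1 hw
  · exact hasSum_zero

lemma weightSum_mul_left (w a b : ℕ) (r : ℝ) (f : ℕ → ℕ → ℕ → ℝ) :
    weightSum w a b (fun s μ ν => r * f s μ ν) = r * weightSum w a b f := by
  simp only [weightSum, Finset.mul_sum, mul_ite, mul_zero]

/-- The sum of `f s ν` over `s ≥ 0` and `ν ≥ b` with `n + ν + 2 s = w`. -/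
def weightSumOne (n w b : ℕ) (f : ℕ → ℕ → ℝ) : ℝ :=
  ∑ ν ∈ Icc b w, ∑ s ∈ range (w + 1), if n + ν + 2 * s = w then f s ν else 0

lemma sum_mul_eq_weightSumOne (n w b : ℕ) (z F : ℕ → ℝ) :
    ∑ s ∈ range (w + 1), z s * (∑ μ ∈ Icc b w, if n + μ + 2 * s = w then F μ else 0)
      = weightSumOne n w b fun s μ => z s * F μ := by
  simp only [weightSumOne, Finset.mul_sum, mul_ite, mul_zero]
  exact Finset.sum_comm

lemma weightSumOne_congr {n w b : ℕ} {f g : ℕ → ℕ → ℝ}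
    (h : ∀ s ν, b ≤ ν → n + ν + 2 * s = w → f s ν = g s ν) :
    weightSumOne n w b f = weightSumOne n w b g := by
  refine Finset.sum_congr rfl fun ν hν => Finset.sum_congr rfl fun s _ => ?_
  split_ifs with hw
  · exact h s ν (mem_Icc.1 hν).1 hw
  · rfl

lemma hasSum_weightSumOne {ι : Type*} {n w b : ℕ} {f : ι → ℕ → ℕ → ℝ} {g : ℕ → ℕ → ℝ}
    (h : ∀ s ν, b ≤ ν → n + ν + 2 * s = w → HasSum (fun i => f i s ν) (g s ν)) :
    HasSum (fun i => weightSumOne n w b (f i)) (weightSumOne n w b g) := by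
  refine hasSum_sum fun ν hν => hasSum_sum fun s _ => ?_
  split_ifs with hw
  · exact h s ν (mem_Icc.1 hν).1 hw
  · exact hasSum_zero

lemma weightSumOne_mul_left (n w b : ℕ) (r : ℝ) (f : ℕ → ℕ → ℝ) :
    weightSumOne n w b (fun s ν => r * f s ν) = r * weightSumOne n w b f := by
  simp only [weightSumOne, Finset.mul_sum, mul_ite, mul_zero]

lemma weightSumOne_sub (n w b : ℕ) (f g : ℕ → ℕ → ℝ) :
    weightSumOne n w b (fun s ν => f s ν - g s ν)
      = weightSumOne n w b f - weightSumOne n w b g := by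
  simp only [weightSumOne, ← Finset.sum_sub_distrib]
  refine Finset.sum_congr rfl fun ν _ => Finset.sum_congr rfl fun s _ => ?_
  split_ifs <;> simp

lemma weightSum_eq_add_succ {w a b : ℕ} (hb : b ≤ w) (f : ℕ → ℕ → ℕ → ℝ) :
    weightSum w a b f = weightSumOne b w a (fun s μ => f s μ b) + weightSum w a (b + 1) f := by
  simp only [weightSum, weightSumOne, ← Finset.sum_add_distrib]
  refine Finset.sum_congr rfl fun μ _ => ?_
  rw [← Finset.insert_Icc_add_one_left_eq_Icc hb, Finset.sum_insert (by simp)]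
  congr 1
  refine Finset.sum_congr rfl fun s _ => ?_
  simp only [add_comm μ b]

lemma weightSumOne_eq_add_succ {n w b : ℕ} (hb : b ≤ w) (f : ℕ → ℕ → ℝ) :
    weightSumOne n w b f
      = (∑ s ∈ range (w + 1), if n + b + 2 * s = w then f s b else 0)
        + weightSumOne n w (b + 1) f := by
  rw [weightSumOne, ← Finset.insert_Icc_add_one_left_eq_Icc hb, Finset.sum_insert (by simp)]
  rfl

lemma sum_Icc_sdiff_of_eq_zero {S : Finset ℤ} {f : ℤ → ℝ} (h : ∀ c ∈ S, f c = 0) (N : ℕ) :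
    ∑ k ∈ Icc (-(N : ℤ)) N \ S, f k = ∑ k ∈ Icc (-(N : ℤ)) N, f k := by
  refine Finset.sum_subset sdiff_subset fun k hk hk' => ?_
  exact h k (by_contra fun hkS => hk' (mem_sdiff.2 ⟨hk, hkS⟩))

/-! ### The sums over j with two and three poles -/

lemma tendsto_sum_two_factors {n₁ n₂ n₃ w : ℕ} (h₂ : 1 ≤ n₂) (h₃ : 1 ≤ n₃)
    (hw : w = n₁ + n₂ + n₃) (q : ℕ+) :
    Tendsto (fun N : ℕ => ∑ j ∈ Icc (-(N : ℤ)) N, invPow n₂ j * invPow n₃ (j - q)) atTop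
      (𝓝 (2 * (weightSumOne n₁ w n₃ (fun s μ => evenZeta s * shiftedCoeff n₃ (-q) μ)
        + weightSumOne n₁ w n₂ (fun s μ => evenZeta s * shiftedCoeff n₂ q μ)))) := by
  have hq : (q : ℤ) ≠ 0 := by simp
  have hqR : (q : ℝ) ≠ 0 := by simp
  have hn0 : (0 : ℤ) ∉ ({(q : ℤ)} : Finset ℤ) := by simpa using hq.symm
  let e : ℤ → ℕ := fun c => if c = 0 then n₂ else n₃
  have e0 : e 0 = n₂ := if_pos rfl
  have eq : e q = n₃ := if_neg hq
  have h := tendsto_lineTerm (W := w) (S := {0, (q : ℤ)}) (e := e) (n₂ + n₃)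
    (by rw [Finset.sum_insert hn0, Finset.sum_singleton, e0, eq]) (by omega) (by omega)
  have hterm (j : ℤ) : lineTerm {0, (q : ℤ)} e j = invPow n₂ j * invPow n₃ (j - q) := by
    rw [lineTerm, Finset.prod_insert hn0, Finset.prod_singleton, e0, eq, sub_zero]
  simp only [hterm] at h
  -- Because 0⁻¹ = 0, the summand vanishes at its own poles, so they need not be excluded.
  have hz : ∀ c ∈ ({0, (q : ℤ)} : Finset ℤ), invPow n₂ c * invPow n₃ (c - q) = 0 := by
    intro c hc
    rw [mem_insert, mem_singleton] at hc
    rcases hc with rfl | rfl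
    · rw [invPow_zero_right h₂, zero_mul]
    · rw [sub_self, invPow_zero_right h₃, mul_zero]
  simp only [sum_Icc_sdiff_of_eq_zero hz] at h
  convert h using 3
  rw [residueSum, Finset.sum_insert hn0, Finset.sum_singleton, ← sum_mul_eq_weightSumOne,
    ← sum_mul_eq_weightSumOne]
  congr 1
  · refine Finset.sum_congr rfl fun s _ => ?_
    congr 1
    rw [lineExpansion, Finset.prod_insert hn0, Finset.prod_singleton, e0, eq, ← coeff_shiftedX_two (a := n₂) (neg_ne_zero.2 hqR) h₃ (by omega)]
    simp
  · refine Finset.sum_congr rfl fun s _ => ?_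
    congr 1
    rw [lineExpansion, Finset.prod_insert hn0, Finset.prod_singleton, e0, eq, ← coeff_shiftedX_two (a := n₃) hqR h₂ (by omega), mul_comm]
    simp

lemma tendsto_sum_three_factors {n₁ n₂ n₃ w : ℕ} (h₁ : 1 ≤ n₁) (h₂ : 1 ≤ n₂) (h₃ : 1 ≤ n₃)
    (hw : w = n₁ + n₂ + n₃) (p q : ℕ+) :
    Tendsto (fun N : ℕ => ∑ j ∈ Icc (-(N : ℤ)) N,
        invPow n₁ (j + p) * (invPow n₂ j * invPow n₃ (j - q))) atTop
      (𝓝 (2 * (weightSum w n₂ n₃ (fun s μ ν =>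
          evenZeta s * (shiftedCoeff n₂ (-p) μ * shiftedCoeff n₃ (-(p + q)) ν))
        + (weightSum w n₃ n₁ (fun s μ ν =>
          evenZeta s * (shiftedCoeff n₃ (-q) μ * shiftedCoeff n₁ p ν))
        + weightSum w n₂ n₁ (fun s μ ν =>
          evenZeta s * (shiftedCoeff n₂ q μ * shiftedCoeff n₁ (p + q) ν)))))) := by
  have hp : 0 < (p : ℤ) := by exact_mod_cast p.pos
  have hq : 0 < (q : ℤ) := by exact_mod_cast q.pos
  have hpR : 0 < (p : ℝ) := by exact_mod_cast p.pos
  have hqR : 0 < (q : ℝ) := by exact_mod_cast q.pos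
  have hn0 : (0 : ℤ) ∉ ({(q : ℤ)} : Finset ℤ) := by simpa using hq.ne
  have hnp : -(p : ℤ) ∉ ({0, (q : ℤ)} : Finset ℤ) := by
    rw [mem_insert, mem_singleton]
    omega
  let e : ℤ → ℕ := fun c => if c = -p then n₁ else if c = 0 then n₂ else n₃
  have ep : e (-p) = n₁ := if_pos rfl
  have e0 : e 0 = n₂ := by simp [e]
  have eq : e q = n₃ := by simp only [e]; rw [if_neg (by omega), if_neg (by omega)]
  have h := tendsto_lineTerm (W := w) (S := {-(p : ℤ), 0, (q : ℤ)}) (e := e) (n₁ + (n₂ + n₃))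
    (by rw [Finset.sum_insert hnp, Finset.sum_insert hn0, Finset.sum_singleton, ep, e0, eq])
    (by omega) (by omega)
  have hterm (j : ℤ) : lineTerm {-(p : ℤ), 0, (q : ℤ)} e j
      = invPow n₁ (j + p) * (invPow n₂ j * invPow n₃ (j - q)) := by
    rw [lineTerm, Finset.prod_insert hnp, Finset.prod_insert hn0, Finset.prod_singleton, ep, e0,
      eq, sub_zero, sub_neg_eq_add]
  simp only [hterm] at h
  have hz : ∀ c ∈ ({-(p : ℤ), 0, (q : ℤ)} : Finset ℤ),
      invPow n₁ (c + p) * (invPow n₂ c * invPow n₃ (c - q)) = 0 := by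
    intro c hc
    rw [mem_insert, mem_insert, mem_singleton] at hc
    rcases hc with rfl | rfl | rfl
    · rw [neg_add_cancel, invPow_zero_right h₁, zero_mul]
    · rw [invPow_zero_right h₂, zero_mul, mul_zero]
    · rw [sub_self, invPow_zero_right h₃, mul_zero, mul_zero]
  simp only [sum_Icc_sdiff_of_eq_zero hz] at h
  convert h using 3
  have hexp (c : ℤ) : lineExpansion {-(p : ℤ), 0, (q : ℤ)} e c
      = (shiftedX ((c : ℝ) + p))⁻¹ ^ n₁ *
        ((shiftedX c)⁻¹ ^ n₂ * (shiftedX ((c : ℝ) - q))⁻¹ ^ n₃) := by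
    rw [lineExpansion, Finset.prod_insert hnp, Finset.prod_insert hn0, Finset.prod_singleton, ep,
      e0, eq]
    simp
  rw [residueSum, Finset.sum_insert hnp, Finset.sum_insert hn0, Finset.sum_singleton]
  simp only [← sum_mul_eq_weightSum]
  refine congr_arg₂ _ ?_ (congr_arg₂ _ ?_ ?_) <;>
    refine Finset.sum_congr rfl fun s _ => congr_arg _ ?_
  · rw [hexp, ← coeff_shiftedX_three (a := n₁) (by simp) (by linarith) h₂ h₃ (by omega)]
    push_cast
    rw [neg_add_cancel, neg_add']
  · rw [hexp, ← coeff_shiftedX_three (a := n₂) (by simp) hpR.ne' h₃ h₁ (by omega)]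
    push_cast
    rw [zero_add, zero_sub]
    congr 1
    ring
  · rw [hexp, ← coeff_shiftedX_three (a := n₃) hqR.ne' (by linarith) h₂ h₁ (by omega)]
    push_cast
    rw [sub_self, add_comm (q : ℝ)]
    congr 1
    ring

/-- The part of the residue sum that stays absolutely summable over `p` and `q`. -/
def residueMain (n₁ n₂ n₃ w : ℕ) (p q : ℕ+) : ℝ :=
  (-1) ^ n₁ * weightSum w n₂ n₃ (fun s μ ν =>
      evenZeta s * ((μ - 1).choose (n₂ - 1) : ℝ) * ((ν - 1).choose (n₃ - 1) : ℝ)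
        * (invPow μ p * invPow ν (p + q)))
    + (-1) ^ n₂ * weightSum w n₃ (n₁ + 1) (fun s μ ν =>
      evenZeta s * ((μ - 1).choose (n₃ - 1) : ℝ) * ((ν - 1).choose (n₁ - 1) : ℝ)
        * (invPow μ q * invPow ν p) * (-1) ^ μ)
    + (-1) ^ n₃ * weightSum w n₂ (n₁ + 1) (fun s μ ν =>
      evenZeta s * ((μ - 1).choose (n₂ - 1) : ℝ) * ((ν - 1).choose (n₁ - 1) : ℝ)
        * (invPow μ q * invPow ν (q + p)))

lemma neg_one_pow_eq_of_even_add {a b : ℕ} (h : Even (a + b)) : (-1 : ℝ) ^ a = (-1) ^ b := by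
  rcases Nat.even_or_odd a with ha | ha
  · rw [ha.neg_one_pow, ((Nat.even_add.1 h).1 ha).neg_one_pow]
  · have : Odd b := by
      rw [← Nat.not_even_iff_odd] at ha ⊢
      exact fun hb => ha ((Nat.even_add.1 h).2 hb)
    rw [ha.neg_one_pow, this.neg_one_pow]

lemma shiftedCoeff_cast (b μ : ℕ) (k : ℤ) :
    shiftedCoeff b k μ = (-1) ^ (b + μ) * ((μ - 1).choose (b - 1) : ℝ) * invPow μ k := rfl

lemma shiftedCoeff_neg_cast (b μ : ℕ) (k : ℤ) :
    shiftedCoeff b (-k) μ = (-1) ^ b * ((μ - 1).choose (b - 1) : ℝ) * invPow μ k := by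
  have := shiftedCoeff_cast b μ (-k)
  push_cast at this
  have h1 : (-1 : ℝ) ^ μ * (-1) ^ μ = 1 := by rw [← mul_pow]; norm_num
  rw [this, invPow_neg, pow_add]
  linear_combination ((-1) ^ b * ((μ - 1).choose (b - 1) : ℝ) * invPow μ k) * h1

/-- The three-pole formula minus p^(-n₁) times the two-pole formula. The subtraction affects only
the layers ν = n₁ at the poles 0 and q, and even weight collapses the signs. -/
lemma tendsto_sum_difference {n₁ n₂ n₃ w : ℕ} (h₁ : 1 ≤ n₁) (h₂ : 1 ≤ n₂) (h₃ : 1 ≤ n₃)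
    (hw : w = n₁ + n₂ + n₃) (heven : Even w) (p q : ℕ+) :
    Tendsto (fun N : ℕ => ∑ j ∈ Icc (-(N : ℤ)) N,
        (invPow n₁ (j + p) - invPow n₁ p) * (invPow n₂ j * invPow n₃ (j - q))) atTop
      (𝓝 (2 * (residueMain n₁ n₂ n₃ w p q
        + (-1) ^ n₃ * weightSumOne n₁ w n₂ (fun s μ =>
          evenZeta s * ((μ - 1).choose (n₂ - 1) : ℝ) * invPow μ q
            * (invPow n₁ (q + p) - invPow n₁ p))))) := by
  have h := (tendsto_sum_three_factors h₁ h₂ h₃ hw p q).sub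
    ((tendsto_sum_two_factors h₂ h₃ hw q).const_mul (invPow n₁ p))
  simp only [Finset.mul_sum, ← Finset.sum_sub_distrib, ← sub_mul] at h
  convert h using 2
  -- Pole at -p: here (-1)^(n₂+n₃) = (-1)^n₁.
  have e1 : weightSum w n₂ n₃ (fun s μ ν =>
      evenZeta s * (shiftedCoeff n₂ (-p) μ * shiftedCoeff n₃ (-(p + q)) ν))
      = (-1) ^ n₁ * weightSum w n₂ n₃ (fun s μ ν =>
      evenZeta s * ((μ - 1).choose (n₂ - 1) : ℝ) * ((ν - 1).choose (n₃ - 1) : ℝ)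
        * (invPow μ p * invPow ν (p + q))) := by
    rw [← weightSum_mul_left]
    refine weightSum_congr fun s μ ν hμ hν hs => ?_
    have a1 := shiftedCoeff_neg_cast n₂ μ p
    have a2 := shiftedCoeff_neg_cast n₃ ν (p + q)
    push_cast at a1 a2
    rw [a1, a2, neg_one_pow_eq_of_even_add (a := n₁) (b := n₂ + n₃)
      (by rwa [← add_assoc, ← hw]), pow_add]
    ring
  -- Pole at 0: the layer ν = n₁ is exactly the subtracted two-pole term.
  have e2 : weightSum w n₃ n₁ (fun s μ ν =>
      evenZeta s * (shiftedCoeff n₃ (-q) μ * shiftedCoeff n₁ p ν))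
      = invPow n₁ p * weightSumOne n₁ w n₃ (fun s μ => evenZeta s * shiftedCoeff n₃ (-q) μ)
      + (-1) ^ n₂ * weightSum w n₃ (n₁ + 1) (fun s μ ν =>
      evenZeta s * ((μ - 1).choose (n₃ - 1) : ℝ) * ((ν - 1).choose (n₁ - 1) : ℝ)
        * (invPow μ q * invPow ν p) * (-1) ^ μ) := by
    rw [weightSum_eq_add_succ (by omega), ← weightSum_mul_left, ← weightSumOne_mul_left]
    congr 1
    · refine weightSumOne_congr fun s μ hμ hs => ?_
      have a2 := shiftedCoeff_cast n₁ n₁ p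
      push_cast at a2
      rw [a2, ← two_mul, pow_mul]
      simp
      ring
    · refine weightSum_congr fun s μ ν hμ hν hs => ?_
      have a1 := shiftedCoeff_neg_cast n₃ μ q
      have a2 := shiftedCoeff_cast n₁ ν p
      push_cast at a1 a2
      have : (-1 : ℝ) ^ n₃ * (-1) ^ (n₁ + ν) = (-1) ^ n₂ * (-1) ^ μ := by
        rw [← pow_add, ← pow_add]
        apply neg_one_pow_eq_of_even_add
        obtain ⟨m, hm⟩ := heven
        exact ⟨m + m - s, by omega⟩
      rw [a1, a2]
      linear_combination (evenZeta s * ((μ - 1).choose (n₃ - 1) : ℝ) *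
        ((ν - 1).choose (n₁ - 1) : ℝ) * (invPow μ q * invPow ν p)) * this
  have hsign (s μ ν : ℕ) (hs : μ + ν + 2 * s = w) :
      (-1 : ℝ) ^ (n₂ + μ) * (-1) ^ (n₁ + ν) = (-1) ^ n₃ := by
    rw [← pow_add]
    apply neg_one_pow_eq_of_even_add
    obtain ⟨m, hm⟩ := heven
    exact ⟨m + m - s, by omega⟩
  -- Pole at q: the layer ν = n₁ carries (q+p)^(-n₁), so the subtraction leaves a difference
  -- summable over p.
  have e3 : weightSum w n₂ n₁ (fun s μ ν =>
      evenZeta s * (shiftedCoeff n₂ q μ * shiftedCoeff n₁ (p + q) ν))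
      - invPow n₁ p * weightSumOne n₁ w n₂ (fun s μ => evenZeta s * shiftedCoeff n₂ q μ)
      = (-1) ^ n₃ * weightSum w n₂ (n₁ + 1) (fun s μ ν =>
      evenZeta s * ((μ - 1).choose (n₂ - 1) : ℝ) * ((ν - 1).choose (n₁ - 1) : ℝ)
        * (invPow μ q * invPow ν (q + p)))
      + (-1) ^ n₃ * weightSumOne n₁ w n₂ (fun s μ =>
          evenZeta s * ((μ - 1).choose (n₂ - 1) : ℝ) * invPow μ q
            * (invPow n₁ (q + p) - invPow n₁ p)) := by
    rw [weightSum_eq_add_succ (by omega), ← weightSum_mul_left, ← weightSumOne_mul_left,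
      ← weightSumOne_mul_left, add_sub_right_comm, ← weightSumOne_sub, add_comm]
    have b (ν : ℕ) : shiftedCoeff n₁ ((p : ℝ) + q) ν
        = (-1) ^ (n₁ + ν) * ((ν - 1).choose (n₁ - 1) : ℝ) * invPow ν (q + p) := by
      have := shiftedCoeff_cast n₁ ν (q + p)
      push_cast at this
      rw [← this, add_comm]
    have b' (μ : ℕ) : shiftedCoeff n₂ (q : ℝ) μ
        = (-1) ^ (n₂ + μ) * ((μ - 1).choose (n₂ - 1) : ℝ) * invPow μ q :=
      shiftedCoeff_cast n₂ μ q
    congr 1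
    · refine weightSum_congr fun s μ ν hμ hν hs => ?_
      rw [b, b', ← hsign s μ ν hs]
      ring
    · refine weightSumOne_congr fun s μ hμ hs => ?_
      have h0 : (-1 : ℝ) ^ (n₁ + n₁) = 1 := (Even.add_self n₁).neg_one_pow
      have := hsign s μ n₁ (by omega)
      rw [h0, mul_one] at this
      rw [b, b', h0, this, Nat.choose_self, Nat.cast_one]
      ring
  rw [residueMain, e1, e2]
  linear_combination -2 * e3

/-! ### Zeta values through harmonic sums -/

lemma hasSum_harmonicBelow_mul_one {a b : ℕ} (ha : 1 ≤ a) (hb : 2 ≤ b) :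
    HasSum (fun j : ℕ+ => harmonicBelow a j * invPow b j) (mzv ![a, b]) := by
  have h := HasSum.harmonicBelow_mul (β := Unit) ha (φ := fun j _ => invPow b j)
    (S := mzv ![a, b]) (by
      have := (Equiv.prodCongr (Equiv.refl ℕ+) (Equiv.prodPUnit ℕ+)).hasSum_iff.2
        (hasSum_mzv_two ha hb)
      refine Eq.mp (congr_arg (HasSum · _) (funext fun x => ?_)) this
      simp)
  exact (Equiv.prodPUnit ℕ+).symm.hasSum_iff.2 h

lemma hasSum_harmonicBelow_mul_two {a b c : ℕ} (ha : 1 ≤ a) (hb : 1 ≤ b) (hc : 2 ≤ c) :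
    HasSum (fun x : ℕ+ × ℕ+ => harmonicBelow a x.1 * (invPow b x.1 * invPow c (x.1 + x.2)))
      (mzv ![a, b, c]) := by
  refine HasSum.harmonicBelow_mul ha (φ := fun j q : ℕ+ => invPow b j * invPow c (j + q)) ?_
  refine Eq.mp (congr_arg (HasSum · _) (funext fun x => ?_)) (hasSum_mzv_three ha hb hc)
  push_cast
  rw [mul_assoc]

lemma hasSum_pnat_prod_nat {f : ℕ+ × ℕ → ℝ} {a b : ℝ} (h0 : HasSum (fun j => f (j, 0)) a)
    (h1 : HasSum (fun x : ℕ+ × ℕ+ => f (x.1, x.2)) b) : HasSum f (a + b) := by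
  have i0 : Function.Injective fun j : ℕ+ => (j, 0) := fun x y h => by simpa using h
  have i1 : Function.Injective fun x : ℕ+ × ℕ+ => (x.1, (x.2 : ℕ)) := by
    rintro ⟨x, x'⟩ ⟨y, y'⟩ h
    simpa using h
  have h0' : HasSum (fun x : ℕ+ × ℕ => if x.2 = 0 then f x else 0) a := by
    rw [← i0.hasSum_iff]
    · simpa [Function.comp_def] using h0
    · rintro ⟨j, n⟩ hx
      exact if_neg fun h : n = 0 => hx ⟨j, by rw [h]⟩
  have h1' : HasSum (fun x : ℕ+ × ℕ => if x.2 = 0 then 0 else f x) b := by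
    rw [← i1.hasSum_iff]
    · simpa [Function.comp_def] using h1
    · rintro ⟨j, n⟩ hx
      refine if_pos (by_contra fun h : ¬ n = 0 => hx ⟨(j, ⟨n, Nat.pos_of_ne_zero h⟩), rfl⟩)
  refine Eq.mp (congr_arg (HasSum · _) (funext fun x => ?_)) (h0'.add h1')
  split_ifs <;> simp

/-- The function `j ↦ j ^ (-b) * ∑ m ≤ j, m ^ (-a)` on the positive integers, extended by `0`. -/
def harmonicWeight (a b : ℕ) (j : ℤ) : ℝ :=
  if 0 < j then harmonicBelow a (j.toNat + 1) * invPow b j else 0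

lemma harmonicWeight_pnat (a b : ℕ) (j : ℕ+) :
    harmonicWeight a b j = harmonicBelow a (j + 1) * invPow b j := by
  rw [harmonicWeight, if_pos (by exact_mod_cast j.pos), Int.toNat_natCast]

lemma harmonicWeight_of_nonpos (a b : ℕ) {j : ℤ} (hj : j ≤ 0) : harmonicWeight a b j = 0 :=
  if_neg hj.not_gt

/-- The four values come from separating m = j from m < j in the harmonic sum, and shift 0 from
positive shifts. -/
lemma hasSum_harmonicWeight_tail {a b c : ℕ} (ha : 1 ≤ a) (hb : 1 ≤ b) (hc : 2 ≤ c) :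
    HasSum (fun x : ℕ+ × ℕ => harmonicWeight a b x.1 * invPow c (x.1 + x.2))
      (mzv ![a, b + c] + mzv ![a + b + c] + (mzv ![a, b, c] + mzv ![a + b, c])) := by
  refine hasSum_pnat_prod_nat ?_ ?_
  · refine Eq.mp (congr_arg (HasSum · _) (funext fun j => ?_))
      ((hasSum_harmonicBelow_mul_one ha (show 2 ≤ b + c by omega)).add
        (hasSum_mzv_one (n := a + b + c) (by omega)))
    simp only [harmonicWeight_pnat, harmonicBelow_succ, Nat.cast_zero, add_zero,
      ← invPow_mul_invPow]
    ring
  · refine Eq.mp (congr_arg (HasSum · _) (funext fun x => ?_))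
      ((hasSum_harmonicBelow_mul_two ha hb hc).add
        (hasSum_mzv_two (a := a + b) (b := c) (by omega) hc))
    simp only [harmonicWeight_pnat, harmonicBelow_succ, ← invPow_mul_invPow]
    ring

/-! ### Differences of the harmonic weight: absolute convergence and total sum -/

/-- `max 1 |j|`. -/
def intSize (j : ℤ) : ℝ := max 1 |(j : ℝ)|

lemma one_le_intSize (j : ℤ) : 1 ≤ intSize j := le_max_left _ _

lemma intSize_of_pos {j : ℤ} (hj : 0 < j) : intSize j = j := by
  have : (1 : ℝ) ≤ j := by exact_mod_cast hj
  rw [intSize, abs_of_nonneg (by linarith), max_eq_right this]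

lemma intSize_of_ne_zero {j : ℤ} (hj : j ≠ 0) : intSize j = |(j : ℝ)| :=
  max_eq_right (by exact_mod_cast Int.one_le_abs hj)

lemma summable_intSize_rpow : Summable fun j : ℤ => intSize j ^ (-(5 / 4) : ℝ) := by
  refine (Real.summable_abs_int_rpow (b := 5 / 4) (by norm_num)).congr_cofinite ?_
  filter_upwards [(Set.finite_singleton (0 : ℤ)).compl_mem_cofinite] with j hj
  rw [intSize_of_ne_zero (by simpa using hj)]

lemma harmonicBelow_nonneg (a j : ℕ) : 0 ≤ harmonicBelow a j :=
  Finset.sum_nonneg fun m _ => invPow_nonneg_of_nonneg a (Int.natCast_nonneg m)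

lemma harmonicBelow_succ_le {a j : ℕ} (ha : 1 ≤ a) (hj : 1 ≤ j) :
    harmonicBelow a (j + 1) ≤ 5 * (j : ℝ) ^ (1 / 4 : ℝ) := by
  have h1 : harmonicBelow a (j + 1) ≤ (harmonic j : ℝ) := by
    rw [harmonicBelow, Finset.sum_range_succ', harmonic, Rat.cast_sum]
    simp only [Nat.cast_zero, invPow_zero_right ha, add_zero]
    refine Finset.sum_le_sum fun m _ => ?_
    have := (le_abs_self _).trans (abs_invPow_le_of_le ha ((m + 1 : ℕ) : ℤ))
    rw [abs_of_nonneg (invPow_nonneg_of_nonneg 1 (by positivity))] at this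
    simpa [invPow] using this
  have h2 := harmonic_le_one_add_log j
  -- This gives log j ≤ 4 j^(1/4), so 1 + log j is at most 5 j^(1/4).
  have h3 := Real.log_le_rpow_div (Nat.cast_nonneg (α := ℝ) j) (ε := 1 / 4) (by norm_num)
  have h4 : 1 ≤ (j : ℝ) ^ (1 / 4 : ℝ) :=
    Real.one_le_rpow (by exact_mod_cast hj) (by norm_num)
  linarith

lemma harmonicWeight_nonneg (a b : ℕ) (j : ℤ) : 0 ≤ harmonicWeight a b j := by
  rw [harmonicWeight]
  split_ifs with h
  · exact mul_nonneg (harmonicBelow_nonneg _ _) (invPow_nonneg_of_nonneg _ h.le)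
  · exact le_rfl

lemma harmonicWeight_natCast (a b : ℕ) {j : ℕ} (hj : 1 ≤ j) :
    harmonicWeight a b j = harmonicBelow a (j + 1) * invPow b j :=
  harmonicWeight_pnat a b ⟨j, hj⟩

lemma invPow_natCast_le {b : ℕ} (hb : 1 ≤ b) (j : ℕ) : invPow b j ≤ (j : ℝ)⁻¹ := by
  have := (le_abs_self _).trans (abs_invPow_le_of_le hb (j : ℤ))
  rw [abs_of_nonneg (invPow_nonneg_of_nonneg 1 (by positivity))] at this
  simpa [invPow] using this

lemma rpow_quarter_mul_inv {x : ℝ} (hx : 0 < x) :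
    x ^ (1 / 4 : ℝ) * x⁻¹ = x ^ (-(3 / 4) : ℝ) := by
  rw [← Real.rpow_neg_one, ← Real.rpow_add hx]
  norm_num

lemma harmonicWeight_le {a b : ℕ} (ha : 1 ≤ a) (hb : 1 ≤ b) (j : ℤ) :
    harmonicWeight a b j ≤ 5 * intSize j ^ (-(3 / 4) : ℝ) := by
  rcases le_or_gt j 0 with hj | hj
  · rw [harmonicWeight_of_nonpos a b hj]
    have := one_le_intSize j
    positivity
  · lift j to ℕ using hj.le
    have hj' : 1 ≤ j := by omega
    have hjR : (0 : ℝ) < j := by exact_mod_cast hj'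
    rw [intSize_of_pos hj, harmonicWeight_natCast a b hj', Int.cast_natCast,
      ← rpow_quarter_mul_inv hjR, ← mul_assoc]
    exact mul_le_mul (harmonicBelow_succ_le ha hj') (invPow_natCast_le hb j)
      (invPow_nonneg_of_nonneg _ (by positivity)) (by positivity)

lemma harmonicBelow_sub_le {a : ℕ} (ha : 1 ≤ a) {j q : ℕ} (hj : 1 ≤ j) (hjq : j ≤ q) :
    harmonicBelow a (q + 1) - harmonicBelow a (j + 1) ≤ (q - j) * (j : ℝ)⁻¹ := by
  have hjR : (0 : ℝ) < j := by exact_mod_cast hj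
  induction q, hjq using Nat.le_induction with
  | base => simp
  | succ q hq ih =>
    rw [harmonicBelow_succ]
    have h1 := invPow_natCast_le ha (q + 1)
    have h2 : ((q + 1 : ℕ) : ℝ)⁻¹ ≤ (j : ℝ)⁻¹ := by
      gcongr
      omega
    push_cast at h1 h2 ⊢
    linarith

/-- A discrete derivative bound, whose factor q - j will offset one power of the denominator. For j
> 0 it is the product rule; for j ≤ 0 < q the jump at the origin is paid for by q - j ≥ `intSize j`.
-/
lemma abs_harmonicWeight_sub_le_of_lt {a b : ℕ} (ha : 1 ≤ a) (hb : 1 ≤ b) {j q : ℤ}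
    (hjq : j < q) :
    |harmonicWeight a b j - harmonicWeight a b q|
      ≤ (5 * b + 1) * (q - j) *
        (intSize j ^ (-(3 / 4) : ℝ) * intSize q ^ (-(3 / 4) : ℝ)) := by
  have hd : (1 : ℝ) ≤ q - j := by exact_mod_cast (show (1 : ℤ) ≤ q - j by omega)
  have hbR : (1 : ℝ) ≤ b := by exact_mod_cast hb
  have hMq := one_le_intSize q
  have hMj := one_le_intSize j
  rcases le_or_gt q 0 with hq | hq
  · rw [harmonicWeight_of_nonpos a b hq, harmonicWeight_of_nonpos a b (by omega), sub_zero,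
      abs_zero]
    positivity
  rcases le_or_gt j 0 with hj | hj
  · rw [harmonicWeight_of_nonpos a b hj, zero_sub, abs_neg,
      abs_of_nonneg (harmonicWeight_nonneg a b q)]
    have h1 : intSize j ≤ q - j := by
      refine max_le hd ?_
      have : (j : ℝ) ≤ 0 := by exact_mod_cast hj
      have : (0 : ℝ) < q := by exact_mod_cast hq
      rw [abs_of_nonpos ‹_›]
      linarith
    have h2 : 1 ≤ (q - j) * intSize j ^ (-(3 / 4) : ℝ) := by
      calc (1 : ℝ) ≤ intSize j ^ (1 / 4 : ℝ) := Real.one_le_rpow hMj (by norm_num)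
        _ = intSize j * intSize j ^ (-(3 / 4) : ℝ) := by
          rw [← rpow_quarter_mul_inv (by linarith)]
          field_simp
        _ ≤ _ := by gcongr
    calc _ ≤ 5 * intSize q ^ (-(3 / 4) : ℝ) * 1 := by
          rw [mul_one]; exact harmonicWeight_le ha hb q
      _ ≤ (5 * b + 1) * intSize q ^ (-(3 / 4) : ℝ) * ((q - j) * intSize j ^ (-(3 / 4) : ℝ)) := by
          gcongr
          linarith
      _ = _ := by ring
  · lift j to ℕ using hj.le
    lift q to ℕ using hq.le
    have hj1 : 1 ≤ j := by omega
    have hq1 : 1 ≤ q := by omega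
    have hjR : (0 : ℝ) < j := by exact_mod_cast hj1
    have hqR : (0 : ℝ) < q := by exact_mod_cast hq1
    rw [harmonicWeight_natCast a b hj1, harmonicWeight_natCast a b hq1, intSize_of_pos hj,
      intSize_of_pos hq]
    simp only [Int.cast_natCast] at hd ⊢
    have h0 := harmonicBelow_sub_le ha hj1 (show j ≤ q by omega)
    have h0' : harmonicBelow a (j + 1) ≤ harmonicBelow a (q + 1) :=
      Finset.sum_le_sum_of_subset_of_nonneg (range_mono (by omega)) fun m _ _ =>
        invPow_nonneg_of_nonneg a (Int.natCast_nonneg m)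
    have h1 := abs_invPow_sub_le b j q
    have h2 : |(((j : ℤ) : ℝ))⁻¹ - ((q : ℤ) : ℝ)⁻¹| = (q - j) * ((j : ℝ)⁻¹ * (q : ℝ)⁻¹) := by
      rw [Int.cast_natCast, Int.cast_natCast, inv_sub_inv hjR.ne' hqR.ne', abs_of_nonneg]
      · field_simp
      · exact div_nonneg (by linarith) (by positivity)
    rw [h2] at h1
    have h3 := harmonicBelow_succ_le ha hj1
    have h4 := invPow_natCast_le hb q
    have h5 := harmonicBelow_nonneg a (j + 1)
    have h6 : 1 ≤ (j : ℝ) ^ (1 / 4 : ℝ) :=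
      Real.one_le_rpow (by exact_mod_cast hj1) (by norm_num)
    have h7 : 1 ≤ (q : ℝ) ^ (1 / 4 : ℝ) :=
      Real.one_le_rpow (by exact_mod_cast hq1) (by norm_num)
    have h8 : 0 ≤ invPow b (q : ℤ) := invPow_nonneg_of_nonneg _ (by positivity)
    have key : harmonicBelow a (j + 1) * invPow b j - harmonicBelow a (q + 1) * invPow b q
        = harmonicBelow a (j + 1) * (invPow b j - invPow b q)
          - (harmonicBelow a (q + 1) - harmonicBelow a (j + 1)) * invPow b q := by ring
    rw [key, ← rpow_quarter_mul_inv hjR, ← rpow_quarter_mul_inv hqR]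
    have hdd : (0 : ℝ) ≤ q - j := by linarith
    calc _ ≤ |harmonicBelow a (j + 1) * (invPow b j - invPow b q)|
          + |(harmonicBelow a (q + 1) - harmonicBelow a (j + 1)) * invPow b q| := abs_sub _ _
      _ ≤ 5 * (j : ℝ) ^ (1 / 4 : ℝ) * (b * ((q - j) * ((j : ℝ)⁻¹ * (q : ℝ)⁻¹)))
          + (q - j) * (j : ℝ)⁻¹ * (q : ℝ)⁻¹ := by
        rw [abs_mul, abs_mul, abs_of_nonneg h5, abs_of_nonneg (sub_nonneg.2 h0'),
          abs_of_nonneg h8]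
        gcongr
      _ = (5 * b * (j : ℝ) ^ (1 / 4 : ℝ) + 1) * ((q - j) * ((j : ℝ)⁻¹ * (q : ℝ)⁻¹)) * 1 := by
        ring
      _ ≤ ((5 * b + 1) * (j : ℝ) ^ (1 / 4 : ℝ)) * ((q - j) * ((j : ℝ)⁻¹ * (q : ℝ)⁻¹))
          * (q : ℝ) ^ (1 / 4 : ℝ) := by
        gcongr
        linarith
      _ = _ := by ring

lemma abs_harmonicWeight_sub_le {a b : ℕ} (ha : 1 ≤ a) (hb : 1 ≤ b) (j q : ℤ) :
    |harmonicWeight a b j - harmonicWeight a b q|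
      ≤ (5 * b + 1) * |(j : ℝ) - q| *
        (intSize j ^ (-(3 / 4) : ℝ) * intSize q ^ (-(3 / 4) : ℝ)) := by
  rcases lt_trichotomy j q with h | rfl | h
  · have hR : (j : ℝ) < q := by exact_mod_cast h
    rw [abs_sub_comm (j : ℝ), abs_of_pos (sub_pos.2 hR)]
    exact abs_harmonicWeight_sub_le_of_lt ha hb h
  · simp
  · have hR : (q : ℝ) < j := by exact_mod_cast h
    rw [abs_sub_comm, abs_of_pos (sub_pos.2 hR), mul_comm (intSize j ^ _)]
    exact abs_harmonicWeight_sub_le_of_lt ha hb h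

/-- The larger variable y is at least δ/2. Half a power of y is handed to x and a quarter to δ,
raising both exponents to 5/4. -/
lemma rpow_mul_inv_le_of_le {x y δ : ℝ} (hx : 1 ≤ x) (hxy : x ≤ y) (hδ : 0 < δ)
    (h : δ ≤ x + y) :
    x ^ (-(3 / 4) : ℝ) * y ^ (-(3 / 4) : ℝ) * δ⁻¹
      ≤ 2 * (x ^ (-(5 / 4) : ℝ) * δ ^ (-(5 / 4) : ℝ)) := by
  have hx0 : 0 < x := by linarith
  have hy0 : 0 < y := by linarith
  have e1 : y ^ (-(3 / 4) : ℝ) = y ^ (-(1 / 2) : ℝ) * y ^ (-(1 / 4) : ℝ) := by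
    rw [← Real.rpow_add hy0]; norm_num
  have e2 : x ^ (-(5 / 4) : ℝ) = x ^ (-(3 / 4) : ℝ) * x ^ (-(1 / 2) : ℝ) := by
    rw [← Real.rpow_add hx0]; norm_num
  have e3 : δ ^ (-(5 / 4) : ℝ) = δ ^ (-(1 / 4) : ℝ) * δ⁻¹ := by
    rw [← Real.rpow_neg_one, ← Real.rpow_add hδ]; norm_num
  have l1 : y ^ (-(1 / 2) : ℝ) ≤ x ^ (-(1 / 2) : ℝ) :=
    Real.rpow_le_rpow_of_nonpos hx0 hxy (by norm_num)
  have l2 : y ^ (-(1 / 4) : ℝ) ≤ 2 * δ ^ (-(1 / 4) : ℝ) := by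
    calc y ^ (-(1 / 4) : ℝ) ≤ (δ / 2) ^ (-(1 / 4) : ℝ) :=
          Real.rpow_le_rpow_of_nonpos (by linarith) (by linarith) (by norm_num)
      _ = 2 ^ (1 / 4 : ℝ) * δ ^ (-(1 / 4) : ℝ) := by
        rw [Real.div_rpow hδ.le (by norm_num), Real.rpow_neg (x := 2) (by norm_num)]
        field_simp
      _ ≤ 2 ^ (1 : ℝ) * δ ^ (-(1 / 4) : ℝ) := by
        gcongr <;> norm_num
      _ = _ := by rw [Real.rpow_one]
  rw [e1, e2, e3]
  calc _ ≤ x ^ (-(3 / 4) : ℝ) * (x ^ (-(1 / 2) : ℝ) * (2 * δ ^ (-(1 / 4) : ℝ))) * δ⁻¹ := by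
        gcongr
    _ = _ := by ring

lemma rpow_mul_inv_le {x y δ : ℝ} (hx : 1 ≤ x) (hy : 1 ≤ y) (hδ : 0 < δ) (h : δ ≤ x + y) :
    x ^ (-(3 / 4) : ℝ) * y ^ (-(3 / 4) : ℝ) * δ⁻¹
      ≤ 2 * (x ^ (-(5 / 4) : ℝ) * δ ^ (-(5 / 4) : ℝ) + y ^ (-(5 / 4) : ℝ) * δ ^ (-(5 / 4) : ℝ)) := by
  have hx' : 0 ≤ x ^ (-(5 / 4) : ℝ) * δ ^ (-(5 / 4) : ℝ) := by positivity
  have hy' : 0 ≤ y ^ (-(5 / 4) : ℝ) * δ ^ (-(5 / 4) : ℝ) := by positivity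
  rcases le_total x y with hxy | hxy
  · have := rpow_mul_inv_le_of_le hx hxy hδ h
    linarith
  · have := rpow_mul_inv_le_of_le hy hxy hδ (by linarith)
    rw [mul_comm (y ^ (-(3 / 4) : ℝ))] at this
    linarith

lemma summable_harmonicWeight_sub {a b c : ℕ} (ha : 1 ≤ a) (hb : 1 ≤ b) (hc : 2 ≤ c) :
    Summable fun x : ℤ × ℤ =>
      (harmonicWeight a b x.2 - harmonicWeight a b x.1) * invPow c (x.2 - x.1) := by
  have hs := summable_intSize_rpow
  have hnn (j : ℤ) : 0 ≤ intSize j ^ (-(5 / 4) : ℝ) := by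
    have := one_le_intSize j
    positivity
  have hs2 := hs.mul_of_nonneg hs hnn hnn
  have i1 : Function.Injective fun x : ℤ × ℤ => (x.2, x.2 - x.1) := by
    rintro ⟨x, x'⟩ ⟨y, y'⟩ h
    simp only [Prod.mk.injEq] at h ⊢
    omega
  have i2 : Function.Injective fun x : ℤ × ℤ => (x.1, x.2 - x.1) := by
    rintro ⟨x, x'⟩ ⟨y, y'⟩ h
    simp only [Prod.mk.injEq] at h ⊢
    omega
  refine Summable.of_norm_bounded
    ((((hs2.comp_injective i1).add (hs2.comp_injective i2)).mul_left 2).mul_left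
      (5 * b + 1 : ℝ)) fun ⟨q, j⟩ => ?_
  simp only [Real.norm_eq_abs, Function.comp_apply]
  rcases eq_or_ne j q with rfl | hjq
  · rw [sub_self, zero_mul, abs_zero]
    have := hnn j
    have := hnn (j - j)
    positivity
  have hd : (j : ℝ) - q ≠ 0 := sub_ne_zero.2 (by exact_mod_cast hjq)
  have hδ : 0 < |(j : ℝ) - q| := abs_pos.2 hd
  have h1 := abs_harmonicWeight_sub_le ha hb j q
  have h2 : |invPow c (j - q)| ≤ |(j : ℝ) - q|⁻¹ * |(j : ℝ) - q|⁻¹ := by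
    refine (abs_invPow_le_of_le hc (j - q)).trans (le_of_eq ?_)
    rw [invPow, abs_pow, abs_inv, sq]
    push_cast
    rfl
  have h3 := rpow_mul_inv_le (one_le_intSize j) (one_le_intSize q) hδ (by
    refine (abs_sub _ _).trans ?_
    exact add_le_add (le_max_right _ _) (le_max_right _ _))
  have h4 : intSize (j - q) = |(j : ℝ) - q| := by
    rw [intSize_of_ne_zero (sub_ne_zero.2 hjq)]
    push_cast
    rfl
  rw [h4, abs_mul]
  calc _ ≤ ((5 * b + 1) * |(j : ℝ) - q| *
        (intSize j ^ (-(3 / 4) : ℝ) * intSize q ^ (-(3 / 4) : ℝ)))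
        * (|(j : ℝ) - q|⁻¹ * |(j : ℝ) - q|⁻¹) :=
        mul_le_mul h1 h2 (abs_nonneg _) ((abs_nonneg _).trans h1)
    _ = (5 * b + 1) * (intSize j ^ (-(3 / 4) : ℝ) * intSize q ^ (-(3 / 4) : ℝ)
        * |(j : ℝ) - q|⁻¹) := by
        field_simp
    _ ≤ _ := by gcongr

lemma tendsto_harmonicWeight_cofinite {a b : ℕ} (ha : 1 ≤ a) (hb : 1 ≤ b) :
    Tendsto (harmonicWeight a b) cofinite (𝓝 0) := by
  -- The exponent 3/5 turns the power -5/4 into -3/4.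
  have h := summable_intSize_rpow.tendsto_cofinite_zero.rpow_const (p := 3 / 5)
    (Or.inr (by norm_num))
  rw [Real.zero_rpow (by norm_num)] at h
  have h' := h.const_mul 5
  rw [mul_zero] at h'
  refine squeeze_zero (harmonicWeight_nonneg a b) (fun j => ?_) h'
  have := one_le_intSize j
  rw [← Real.rpow_mul (by linarith)]
  norm_num
  simpa using harmonicWeight_le ha hb j

/-- Absolute convergence permits summation along the lines j - q = d, on each of which the
differences telescope to 0. -/
lemma hasSum_harmonicWeight_sub {a b c : ℕ} (ha : 1 ≤ a) (hb : 1 ≤ b) (hc : 2 ≤ c) :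
    HasSum (fun x : ℤ × ℤ =>
      (harmonicWeight a b x.2 - harmonicWeight a b x.1) * invPow c (x.2 - x.1)) 0 := by
  have hs := summable_harmonicWeight_sub ha hb hc
  have i1 : Function.Injective fun j : ℤ => (j, j + 1) := fun x y h => (Prod.mk.inj h).1
  -- The line d = 1 of the double series, where the denominator is 1.
  have h1 : Summable fun j => harmonicWeight a b (j + 1) - harmonicWeight a b j := by
    refine (hs.comp_injective i1).congr fun j => ?_
    simp [invPow]
  have htel := hasSum_int_add_sub (tendsto_harmonicWeight_cofinite ha hb) h1
  have i2 : Function.Injective fun x : ℤ × ℤ => (x.2, x.2 + x.1) := by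
    rintro ⟨x, x'⟩ ⟨y, y'⟩ h
    simp only [Prod.mk.injEq] at h ⊢
    omega
  have h2 := (i2.hasSum_iff fun x hx => absurd ⟨(x.2 - x.1, x.1), by simp⟩ hx).2 hs.hasSum
  have h3 := h2.prod_fiberwise (g := fun _ => 0) fun d => by
    have := (htel d).mul_right (invPow c d)
    rw [zero_mul] at this
    simpa using this
  have := h3.unique hasSum_zero
  rw [← this]
  exact hs.hasSum

/-- The sum over `j` of the differences of `harmonicWeight` at `j` and `q`, divided by
`(j - q) ^ c`. -/
def harmonicDifference (a b c : ℕ) (q : ℤ) : ℝ :=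
  ∑' j : ℤ, (harmonicWeight a b j - harmonicWeight a b q) * invPow c (j - q)

lemma hasSum_harmonicDifference_fiber {a b c : ℕ} (ha : 1 ≤ a) (hb : 1 ≤ b) (hc : 2 ≤ c)
    (q : ℤ) :
    HasSum (fun j : ℤ => (harmonicWeight a b j - harmonicWeight a b q) * invPow c (j - q))
      (harmonicDifference a b c q) :=
  ((summable_harmonicWeight_sub ha hb hc).prod_factor q).hasSum

/-- The total over q ∈ ℤ is 0, and for q ≤ 0 the weight at q vanishes, which leaves the series of
`hasSum_harmonicWeight_tail`. The part q > 0 is its negative. -/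
lemma hasSum_harmonicDifference {a b c : ℕ} (ha : 1 ≤ a) (hb : 1 ≤ b) (hc : 2 ≤ c) :
    HasSum (fun q : ℕ+ => harmonicDifference a b c q)
      (-(mzv ![a, b + c] + mzv ![a + b + c] + (mzv ![a, b, c] + mzv ![a + b, c]))) := by
  have htot := (hasSum_harmonicWeight_sub ha hb hc).prod_fiberwise
    (hasSum_harmonicDifference_fiber ha hb hc)
  have hneg : HasSum (fun q : ℕ => harmonicDifference a b c (-(q : ℤ)))
      (mzv ![a, b + c] + mzv ![a + b + c] + (mzv ![a, b, c] + mzv ![a + b, c])) := by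
    let i : ℕ+ × ℕ → ℕ × ℤ := fun x => (x.2, x.1)
    have hi : Function.Injective i := by
      rintro ⟨x, x'⟩ ⟨y, y'⟩ h
      simp only [i, Prod.mk.injEq] at h
      exact Prod.ext (pnat_injective_cast h.2) h.1
    have h : HasSum (fun x : ℕ × ℤ =>
        (harmonicWeight a b x.2 - harmonicWeight a b (-(x.1 : ℤ))) * invPow c (x.2 - -(x.1 : ℤ)))
        (mzv ![a, b + c] + mzv ![a + b + c] + (mzv ![a, b, c] + mzv ![a + b, c])) := by
      rw [← hi.hasSum_iff]
      · refine Eq.mp (congr_arg (HasSum · _) (funext fun x => ?_))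
          (hasSum_harmonicWeight_tail ha hb hc)
        simp [i, harmonicWeight_of_nonpos]
      · rintro ⟨q, j⟩ hx
        simp only
        rw [harmonicWeight_of_nonpos a b (j := j), harmonicWeight_of_nonpos a b (by omega),
          sub_zero, zero_mul]
        by_contra! hj
        exact hx ⟨(⟨j.toNat, by omega⟩, q), by
          simp only [i, PNat.mk_coe]
          rw [Int.toNat_of_nonneg hj.le]⟩
    exact h.prod_fiberwise fun q => hasSum_harmonicDifference_fiber ha hb hc (-(q : ℤ))
  have i1 : Function.Injective fun q : ℕ+ => ((q : ℕ) : ℤ) := pnat_injective_cast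
  have hpos : HasSum (fun q : ℕ+ => harmonicDifference a b c q)
      (∑' q : ℕ+, harmonicDifference a b c q) := (htot.summable.comp_injective i1).hasSum
  have hpos' := (hasSum_pnat_iff_hasSum_succ
    (f := fun q : ℕ => harmonicDifference a b c q)).1 hpos
  have hall := HasSum.of_nat_of_neg_add_one (f := fun q => harmonicDifference a b c (-q)) hneg
    (by simpa using hpos')
  have := hall.unique ((Equiv.neg ℤ).hasSum_iff.2 htot)
  rw [eq_neg_of_add_eq_zero_right this] at hpos
  exact hpos

/-! ### Summation over p and exchange with j -/

lemma hasSum_invPow_shift_step {n : ℕ} (hn : 1 ≤ n) (m : ℤ) :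
    HasSum (fun p : ℕ+ => invPow n (m + 1 + p) - invPow n (m + p)) (-invPow n (m + 1)) := by
  have hinj : Function.Injective fun p : ℕ => m + 1 + (p : ℤ) := fun x y h => by simpa using h
  have h := hasSum_nat_telescoping (a := fun p : ℕ => invPow n (m + 1 + p))
    ((tendsto_invPow_cofinite hn).comp (Nat.cofinite_eq_atTop ▸ hinj.tendsto_cofinite))
    (((summable_invPow_add_sub n 1).comp_injective hinj).congr fun p => by simp [add_assoc])
  refine (hasSum_pnat_iff_hasSum_succ
    (f := fun p : ℕ => invPow n (m + 1 + p) - invPow n (m + p))).2 ?_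
  simp only [Nat.cast_zero, add_zero] at h
  refine Eq.mp (congr_arg (HasSum · _) (funext fun p => ?_)) h
  push_cast
  rw [add_assoc m 1 (p : ℤ), add_comm (1 : ℤ) (p : ℤ), ← add_assoc]

lemma hasSum_invPow_shift_nat {n : ℕ} (hn : 1 ≤ n) (j : ℕ) :
    HasSum (fun p : ℕ+ => invPow n (j + p) - invPow n p) (-harmonicBelow n (j + 1)) := by
  induction j with
  | zero => simp [harmonicBelow, invPow_zero_right hn]
  | succ j ih =>
    have h := (hasSum_invPow_shift_step hn j).add ih
    rw [harmonicBelow_succ, neg_add_rev]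
    push_cast
    simpa using h

/-- Telescoping leaves the terms (p-i)^(-n) with p < i, which give the sign. The term p = i is 0 by
convention, so the harmonic sum stops below i. -/
lemma hasSum_invPow_shift_neg {n : ℕ} (hn : 1 ≤ n) (i : ℕ) :
    HasSum (fun p : ℕ+ => invPow n (-i + p) - invPow n p) ((-1) ^ n * harmonicBelow n i) := by
  induction i with
  | zero => simp [harmonicBelow]
  | succ i ih =>
    have h := ih.sub (hasSum_invPow_shift_step hn (-(i : ℤ) - 1))
    rw [sub_add_cancel, sub_neg_eq_add, invPow_neg, ← mul_add, ← harmonicBelow_succ] at h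
    refine Eq.mp (congr_arg (HasSum · _) (funext fun p => ?_)) h
    push_cast
    rw [neg_add']
    ring

/-- The factor j^(-n₂) is spent on making the difference in p quadratically small; (j-q)^(-n₃) alone
then controls j. -/
lemma summable_shift_mul {n₁ n₂ n₃ : ℕ} (h₂ : 1 ≤ n₂) (h₃ : 2 ≤ n₃) (q : ℤ) :
    Summable fun x : ℕ+ × ℤ =>
      (invPow n₁ (x.2 + x.1) - invPow n₁ x.1) * (invPow n₂ x.2 * invPow n₃ (x.2 - q)) := by
  have hs := summable_invPow le_rfl
  have hnn (j : ℤ) : 0 ≤ invPow 2 j := sq_nonneg _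
  have hs2 := hs.mul_of_nonneg hs hnn hnn
  have i1 : Function.Injective fun x : ℕ+ × ℤ => (x.2 + (x.1 : ℤ), x.2 - q) := by
    rintro ⟨x, x'⟩ ⟨y, y'⟩ h
    simp only [Prod.mk.injEq] at h
    exact Prod.ext (pnat_injective_cast (by simp only; omega)) (by simp only; omega)
  have i2 : Function.Injective fun x : ℕ+ × ℤ => ((x.1 : ℤ), x.2 - q) := by
    rintro ⟨x, x'⟩ ⟨y, y'⟩ h
    simp only [Prod.mk.injEq] at h
    exact Prod.ext (pnat_injective_cast (by simp only; omega)) (by simp only; omega)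
  refine Summable.of_norm_bounded (((hs2.comp_injective i1).add (hs2.comp_injective i2)).mul_left
    (n₁ : ℝ)) fun ⟨p, j⟩ => ?_
  simp only [Real.norm_eq_abs, Function.comp_apply, abs_mul]
  have h1 := abs_invPow_add_sub_mul_le n₁ j p
  have h2 : |invPow n₂ j| ≤ |(j : ℝ)⁻¹| := by simpa [invPow] using abs_invPow_le_of_le h₂ j
  have h3 : |invPow n₃ (j - q)| ≤ invPow 2 (j - q) := by
    simpa [abs_of_nonneg (hnn _)] using abs_invPow_le_of_le h₃ (j - q)
  calc _ ≤ |invPow n₁ (j + p) - invPow n₁ p| * (|(j : ℝ)⁻¹| * invPow 2 (j - q)) := by gcongr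
    _ = |invPow n₁ (j + p) - invPow n₁ p| * |(j : ℝ)⁻¹| * invPow 2 (j - q) := by ring
    _ ≤ n₁ * (invPow 2 (j + p) + invPow 2 p) * invPow 2 (j - q) :=
      mul_le_mul_of_nonneg_right h1 (hnn _)
    _ = _ := by ring

/-- The tails `∑ i, i ^ (-b) * (i + q) ^ (-c) * ∑ m < i, m ^ (-a)` of a triple zeta value. -/
def tripleTail (a b c : ℕ) (q : ℕ+) : ℝ :=
  ∑' i : ℕ+, harmonicBelow a i * (invPow b i * invPow c (i + q))

lemma hasSum_tripleTail_fiber {a b c : ℕ} (ha : 1 ≤ a) (hb : 1 ≤ b) (hc : 2 ≤ c) (q : ℕ+) :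
    HasSum (fun i : ℕ+ => harmonicBelow a i * (invPow b i * invPow c (i + q)))
      (tripleTail a b c q) :=
  ((hasSum_harmonicBelow_mul_two ha hb hc).summable.prod_symm.prod_factor q).hasSum

lemma hasSum_tripleTail {a b c : ℕ} (ha : 1 ≤ a) (hb : 1 ≤ b) (hc : 2 ≤ c) :
    HasSum (tripleTail a b c) (mzv ![a, b, c]) :=
  HasSum.prod_fiberwise
    ((Equiv.prodComm ℕ+ ℕ+).hasSum_iff.2 (hasSum_harmonicBelow_mul_two ha hb hc))
    fun q => hasSum_tripleTail_fiber ha hb hc q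

/-- For j < 0, reflecting all three factors costs (-1)^(n₁+n₂+n₃) = 1, so the triple tail enters
with a plus sign. For j > 0 the weight at q is subtracted and restored as a multiple of
`twoSidedZeta n₃`. -/
lemma hasSum_shift_mul_fiber {n₁ n₂ n₃ : ℕ} (h₁ : 1 ≤ n₁) (h₂ : 1 ≤ n₂) (h₃ : 2 ≤ n₃)
    (heven : Even (n₁ + n₂ + n₃)) (q : ℕ+) :
    HasSum (fun j : ℤ => ∑' p : ℕ+,
        (invPow n₁ (j + p) - invPow n₁ p) * (invPow n₂ j * invPow n₃ (j - q)))
      (-(harmonicDifference n₁ n₂ n₃ q + harmonicWeight n₁ n₂ q * twoSidedZeta n₃)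
        + tripleTail n₁ n₂ n₃ q) := by
  have hZ : HasSum (fun j : ℤ => invPow n₃ (j - q)) (twoSidedZeta n₃) :=
    (Equiv.subRight (q : ℤ)).hasSum_iff.2 (hasSum_int_invPow h₃)
  have hg : HasSum (fun j : ℤ => harmonicWeight n₁ n₂ j * invPow n₃ (j - q))
      (harmonicDifference n₁ n₂ n₃ q + harmonicWeight n₁ n₂ q * twoSidedZeta n₃) := by
    refine Eq.mp (congr_arg (HasSum · _) (funext fun j => ?_))
      ((hasSum_harmonicDifference_fiber h₁ h₂ h₃ q).add (hZ.mul_left (harmonicWeight n₁ n₂ q)))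
    ring
  let i : ℕ+ → ℤ := fun k => -k
  have hi : Function.Injective i := fun x y h => pnat_injective_cast (neg_injective h)
  have ht : HasSum (fun j : ℤ => if j < 0 then
      harmonicBelow n₁ (-j).toNat * (invPow n₂ (-j) * invPow n₃ (-j + q)) else 0)
      (tripleTail n₁ n₂ n₃ q) := by
    rw [← hi.hasSum_iff]
    · refine Eq.mp (congr_arg (HasSum · _) (funext fun k => ?_))
        (hasSum_tripleTail_fiber h₁ h₂ h₃ q)
      simp [i]
    · intro j hj
      refine if_neg fun hj0 => hj ⟨⟨(-j).toNat, by omega⟩, ?_⟩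
      simp only [i, PNat.mk_coe]
      omega
  refine Eq.mp (congr_arg (HasSum · _) (funext fun j => ?_)) (hg.neg.add ht)
  rw [tsum_mul_right]
  rcases lt_or_ge j 0 with hj | hj
  · obtain ⟨k, rfl⟩ : ∃ k : ℕ, j = -(k : ℤ) := ⟨(-j).toNat, by omega⟩
    rw [harmonicWeight_of_nonpos n₁ n₂ hj.le, if_pos hj, (hasSum_invPow_shift_neg h₁ k).tsum_eq,
      ← neg_add', neg_neg, invPow_neg n₂ (k : ℤ),
      invPow_neg n₃ ((k : ℤ) + q), Int.toNat_natCast]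
    have : (-1 : ℝ) ^ n₁ * (-1) ^ n₂ * (-1) ^ n₃ = 1 := by
      rw [← pow_add, ← pow_add, heven.neg_one_pow]
    linear_combination -(harmonicBelow n₁ k * (invPow n₂ k * invPow n₃ (k + q))) * this
  · lift j to ℕ using hj
    rw [if_neg (by omega), (hasSum_invPow_shift_nat h₁ j).tsum_eq, add_zero]
    rcases Nat.eq_zero_or_pos j with rfl | hj
    · rw [Nat.cast_zero, invPow_zero_right h₂, harmonicWeight_of_nonpos n₁ n₂ le_rfl]
      ring
    · rw [harmonicWeight_natCast n₁ n₂ hj]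
      ring

/-- Two evaluations of one absolutely convergent double sum: with j inside by the cotangent formula,
with p inside by harmonic sums. -/
lemma hasSum_residue {n₁ n₂ n₃ w : ℕ} (h₁ : 1 ≤ n₁) (h₂ : 1 ≤ n₂) (h₃ : 2 ≤ n₃)
    (hw : w = n₁ + n₂ + n₃) (heven : Even w) (q : ℕ+) :
    HasSum (fun p : ℕ+ => 2 * (residueMain n₁ n₂ n₃ w p q
        + (-1) ^ n₃ * weightSumOne n₁ w n₂ (fun s μ =>
          evenZeta s * ((μ - 1).choose (n₂ - 1) : ℝ) * invPow μ q
            * (invPow n₁ (q + p) - invPow n₁ p))))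
      (-(harmonicDifference n₁ n₂ n₃ q + harmonicWeight n₁ n₂ q * twoSidedZeta n₃)
        + tripleTail n₁ n₂ n₃ q) := by
  have hs := summable_shift_mul (n₁ := n₁) h₂ h₃ (q : ℤ)
  have hp := hs.hasSum.prod_fiberwise (g := fun p : ℕ+ => 2 * (residueMain n₁ n₂ n₃ w p q
        + (-1) ^ n₃ * weightSumOne n₁ w n₂ (fun s μ =>
          evenZeta s * ((μ - 1).choose (n₂ - 1) : ℝ) * invPow μ q
            * (invPow n₁ (q + p) - invPow n₁ p)))) fun p => by
    have hf := (hs.prod_factor p).hasSum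
    rwa [tendsto_nhds_unique hf.tendsto_sum_Icc_neg
      (tendsto_sum_difference h₁ h₂ (by omega) hw heven p q)] at hf
  have hj := ((Equiv.prodComm ℤ ℕ+).hasSum_iff.2 hs.hasSum).prod_fiberwise
    fun j => (hs.prod_symm.prod_factor j).hasSum
  rwa [hj.unique (hasSum_shift_mul_fiber h₁ h₂ h₃ (hw ▸ heven) q)] at hp

/-! ### Cancelling the divergent layer and summing over q -/

lemma neg_one_pow_mul_twoSidedZeta (n : ℕ) : (-1) ^ n * twoSidedZeta n = twoSidedZeta n := by
  rw [twoSidedZeta]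
  split_ifs with h
  · rw [h.neg_one_pow, one_mul]
  · rw [mul_zero]

lemma sum_evenZeta_ite {n m w : ℕ} (hn : 1 ≤ n) (hw : w = m + n) :
    2 * ∑ s ∈ range (w + 1), (if m + 2 * s = w then evenZeta s else 0) = twoSidedZeta n := by
  rw [← sum_evenZeta_mul_coeff_shiftedX_zero hn (show n ≤ w by omega)]
  congr 1
  refine Finset.sum_congr rfl fun s _ => ?_
  rw [shiftedX_zero_inv_pow]
  split_ifs with h
  · rw [show -(2 * s : ℤ) = -n by omega, HahnSeries.coeff_single_same, mul_one]
  · rw [HahnSeries.coeff_single_of_ne (by omega), mul_zero]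

/-- After summation over p, the layer μ = n₂ forces 2s = n₃ and cancels the term in `twoSidedZeta
n₃`. Each of the two could diverge over q, as happens for n₂ = 1 and n₃ even. -/
lemma hasSum_residueMain_fiber {n₁ n₂ n₃ w : ℕ} (h₁ : 1 ≤ n₁) (h₂ : 1 ≤ n₂) (h₃ : 2 ≤ n₃)
    (hw : w = n₁ + n₂ + n₃) (heven : Even w) (q : ℕ+) :
    HasSum (fun p : ℕ+ => 2 * residueMain n₁ n₂ n₃ w p q)
      (-harmonicDifference n₁ n₂ n₃ q + tripleTail n₁ n₂ n₃ q
        + 2 * (-1) ^ n₃ * weightSumOne n₁ w (n₂ + 1) (fun s μ =>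
          evenZeta s * ((μ - 1).choose (n₂ - 1) : ℝ)
            * (harmonicBelow n₁ q * invPow μ q + invPow (n₁ + μ) q))) := by
  have hL : HasSum (fun p : ℕ+ => weightSumOne n₁ w n₂ (fun s μ =>
      evenZeta s * ((μ - 1).choose (n₂ - 1) : ℝ) * invPow μ q
        * (invPow n₁ (q + p) - invPow n₁ p)))
      (weightSumOne n₁ w n₂ (fun s μ => evenZeta s * ((μ - 1).choose (n₂ - 1) : ℝ) * invPow μ q
        * -harmonicBelow n₁ (q + 1))) :=
    hasSum_weightSumOne fun s μ _ _ => (hasSum_invPow_shift_nat h₁ q).mul_left _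
  have hsplit : 2 * weightSumOne n₁ w n₂ (fun s μ => evenZeta s *
      ((μ - 1).choose (n₂ - 1) : ℝ) * invPow μ q * -harmonicBelow n₁ (q + 1))
      = -(harmonicWeight n₁ n₂ q * twoSidedZeta n₃)
        - 2 * weightSumOne n₁ w (n₂ + 1) (fun s μ =>
          evenZeta s * ((μ - 1).choose (n₂ - 1) : ℝ)
            * (harmonicBelow n₁ q * invPow μ q + invPow (n₁ + μ) q)) := by
    have e1 : (∑ s ∈ range (w + 1), if n₁ + n₂ + 2 * s = w then
        evenZeta s * ((n₂ - 1).choose (n₂ - 1) : ℝ) * invPow n₂ q * -harmonicBelow n₁ (q + 1)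
          else 0)
        = -(harmonicBelow n₁ (q + 1) * invPow n₂ q)
          * ∑ s ∈ range (w + 1), if n₁ + n₂ + 2 * s = w then evenZeta s else 0 := by
      rw [Finset.mul_sum]
      refine Finset.sum_congr rfl fun s _ => ?_
      split_ifs
      · rw [Nat.choose_self, Nat.cast_one]
        ring
      · rw [mul_zero]
    have e2 : weightSumOne n₁ w (n₂ + 1) (fun s μ => evenZeta s *
        ((μ - 1).choose (n₂ - 1) : ℝ) * invPow μ q * -harmonicBelow n₁ (q + 1))
        = -1 * weightSumOne n₁ w (n₂ + 1) (fun s μ =>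
          evenZeta s * ((μ - 1).choose (n₂ - 1) : ℝ)
            * (harmonicBelow n₁ q * invPow μ q + invPow (n₁ + μ) q)) := by
      rw [← weightSumOne_mul_left]
      refine weightSumOne_congr fun s μ _ _ => ?_
      rw [harmonicBelow_succ, ← invPow_mul_invPow]
      ring
    rw [weightSumOne_eq_add_succ (by omega), ← sum_evenZeta_ite (show 1 ≤ n₃ by omega) hw,
      harmonicWeight_pnat]
    linear_combination 2 * e1 + 2 * e2
  have h := (hasSum_residue h₁ h₂ h₃ hw heven q).sub (hL.mul_left (2 * (-1) ^ n₃))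
  rw [show -(harmonicDifference n₁ n₂ n₃ q + harmonicWeight n₁ n₂ q * twoSidedZeta n₃)
      + tripleTail n₁ n₂ n₃ q - 2 * (-1) ^ n₃ * weightSumOne n₁ w n₂ (fun s μ =>
        evenZeta s * ((μ - 1).choose (n₂ - 1) : ℝ) * invPow μ q * -harmonicBelow n₁ (q + 1))
      = -harmonicDifference n₁ n₂ n₃ q + tripleTail n₁ n₂ n₃ q
        + 2 * (-1) ^ n₃ * weightSumOne n₁ w (n₂ + 1) (fun s μ =>
          evenZeta s * ((μ - 1).choose (n₂ - 1) : ℝ)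
            * (harmonicBelow n₁ q * invPow μ q + invPow (n₁ + μ) q)) by
    linear_combination -(-1 : ℝ) ^ n₃ * hsplit
      + harmonicWeight n₁ n₂ q * neg_one_pow_mul_twoSidedZeta n₃] at h
  refine Eq.mp (congr_arg (HasSum · _) (funext fun p => ?_)) h
  ring

lemma hasSum_residueMain {n₁ n₂ n₃ w : ℕ} (h₁ : 1 ≤ n₁) (h₂ : 1 ≤ n₂) (h₃ : 2 ≤ n₃) :
    HasSum (fun x : ℕ+ × ℕ+ => residueMain n₁ n₂ n₃ w x.2 x.1)
      ((-1 : ℝ) ^ n₁ * weightSum w n₂ n₃ (fun s μ ν =>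
          evenZeta s * ((μ - 1).choose (n₂ - 1) : ℝ) * ((ν - 1).choose (n₃ - 1) : ℝ)
            * mzv ![μ, ν])
      + (-1 : ℝ) ^ n₂ * weightSum w n₃ (n₁ + 1) (fun s μ ν =>
          evenZeta s * ((μ - 1).choose (n₃ - 1) : ℝ) * ((ν - 1).choose (n₁ - 1) : ℝ)
            * mzv ![μ] * mzv ![ν] * (-1 : ℝ) ^ μ)
      + (-1 : ℝ) ^ n₃ * weightSum w n₂ (n₁ + 1) (fun s μ ν =>
          evenZeta s * ((μ - 1).choose (n₂ - 1) : ℝ) * ((ν - 1).choose (n₁ - 1) : ℝ)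
            * mzv ![μ, ν])) := by
  refine HasSum.add (HasSum.add ?_ ?_) ?_ <;>
    refine HasSum.mul_left _ (hasSum_weightSum fun s μ ν hμ hν _ => ?_)
  · exact ((Equiv.prodComm ℕ+ ℕ+).hasSum_iff.2
      (hasSum_mzv_two (show 1 ≤ μ by omega) (show 2 ≤ ν by omega))).mul_left _
  · have hμ' := hasSum_mzv_one (show 2 ≤ μ by omega)
    have hν' := hasSum_mzv_one (show 2 ≤ ν by omega)
    have hnn (n : ℕ) (k : ℕ+) : 0 ≤ invPow n k := invPow_nonneg_of_nonneg n (by positivity)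
    have := hμ'.mul hν' (hμ'.summable.mul_of_nonneg hν'.summable (hnn μ) (hnn ν))
    rw [mul_assoc _ (mzv ![μ])]
    exact (this.mul_left _).mul_right _
  · exact (hasSum_mzv_two (show 1 ≤ μ by omega) (show 2 ≤ ν by omega)).mul_left _

theorem mainTheorem7 (n₁ n₂ n₃ w : ℕ) (h₁ : 1 ≤ n₁) (h₂ : 1 ≤ n₂) (h₃ : 1 < n₃)
    (hw : w = n₁ + n₂ + n₃) (heven : Even w) :
    Summable (mzvTerm ![n₁, n₂, n₃]) ∧
    mzv ![n₁, n₂, n₃] =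
      -(1 / 2 : ℝ) * (mzv ![n₁ + n₂, n₃] + mzv ![n₁, n₂ + n₃] + mzv ![w])
      + (-1 : ℝ) ^ n₁ * weightSum w n₂ n₃ (fun s μ ν =>
          evenZeta s * ((μ - 1).choose (n₂ - 1) : ℝ) * ((ν - 1).choose (n₃ - 1) : ℝ)
            * mzv ![μ, ν])
      + (-1 : ℝ) ^ n₂ * weightSum w n₃ (n₁ + 1) (fun s μ ν =>
          evenZeta s * ((μ - 1).choose (n₃ - 1) : ℝ) * ((ν - 1).choose (n₁ - 1) : ℝ)
            * mzv ![μ] * mzv ![ν] * (-1 : ℝ) ^ μ)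
      + (-1 : ℝ) ^ n₃ * weightSum w n₂ (n₁ + 1) (fun s μ ν =>
          evenZeta s * ((μ - 1).choose (n₂ - 1) : ℝ) * ((ν - 1).choose (n₁ - 1) : ℝ)
            * mzv ![μ, ν])
      - (-1 : ℝ) ^ n₃ * ∑ ν ∈ Icc (n₂ + 1) w, ∑ s ∈ range (w + 1),
          (if n₁ + ν + 2 * s = w then
            evenZeta s * ((ν - 1).choose (n₂ - 1) : ℝ) * (mzv ![n₁, ν] + mzv ![n₁ + ν])
          else 0) := by
  refine ⟨summable_mzvTerm_three h₁ h₂ h₃, ?_⟩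
  have hleft := ((hasSum_residueMain (w := w) h₁ h₂ h₃).mul_left 2).prod_fiberwise
    (hasSum_residueMain_fiber h₁ h₂ h₃ hw heven)
  have hone : HasSum (fun q : ℕ+ => weightSumOne n₁ w (n₂ + 1) (fun s μ =>
      evenZeta s * ((μ - 1).choose (n₂ - 1) : ℝ)
        * (harmonicBelow n₁ q * invPow μ q + invPow (n₁ + μ) q)))
      (weightSumOne n₁ w (n₂ + 1) (fun s μ =>
        evenZeta s * ((μ - 1).choose (n₂ - 1) : ℝ) * (mzv ![n₁, μ] + mzv ![n₁ + μ]))) :=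
    hasSum_weightSumOne fun s μ hμ _ =>
      ((hasSum_harmonicBelow_mul_one h₁ (by omega)).add (hasSum_mzv_one (by omega))).mul_left _
  have hright := ((hasSum_harmonicDifference h₁ h₂ h₃).neg.add (hasSum_tripleTail h₁ h₂ h₃)).add
    (hone.mul_left (2 * (-1) ^ n₃))
  have key := hleft.unique hright
  rw [weightSumOne, ← hw] at key
  -- The triple zeta value occurs in `key` twice, from `hasSum_harmonicDifference` and from
  -- `hasSum_tripleTail`, hence the halving.
  linear_combination (-1 / 2 : ℝ) * key

end
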